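/- Part A (exponential). Let $\nu\ge 1$ and let $X_1,\dots,X_\nu$ be a random sample from $\mathrm{Exp}(\lambda)$, $\lambda>0$, with density $\lambda e^{-\lambda x}$, $x>0$; put $X=X_1+\cdots+X_\nu$, let $\gamma$ be Euler's constant, and let $$L_\nu=-\log X-\gamma+\sum_{j=1}^{\nu-1}\frac1j .$$ Then $L_\nu$ is the uniformly minimum variance unbiased estimator (UMVUE) of $\log\lambda$: it is unbiased with finite variance for every $\lambda>0$, its variance is, for every $\lambda>0$, at most that of any other unbiased estimator of $\log\lambda$ based on the sample, and any UMVUE of $\log\lambda$ equals $L_\nu$ almost surely. Moreover, for every $\lambda>0$, $L_\nu=\mathbb E[-\gamma-\log X_1\mid X]$ almost surely, and $$\operatorname{Var}L_\nu=\sum_{k=1}^\infty\frac{1}{k^2\binom{\nu+k-1}{k}}=\sum_{k\ge\nu}\frac1{k^2}=\frac{\pi^2}{6}-\sum_{j=1}^{\nu-1}\frac1{j^2}.$$ The first term $1/\nu$ of the first series is the Cramér–Rao lower bound for unbiased estimators of $\log\lambda$, and $$1<\nu\operatorname{Var}L_\nu<1+\frac1\nu .$$ In particular $L_\nu$ is asymptotically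 efficient: for every $\lambda>0$ the ratio of $\operatorname{Var}L_\nu$ to the Cramér–Rao bound tends to $1$ as $\nu\to\infty$. Part B (geometric). Let $\nu\ge1$ and let $X_1,\dots,X_\nu$ be a random sample from the geometric distribution $p(x)=\theta(1-\theta)^x$, $x=0,1,2,\dots$, with $0<\theta<1$; put $X=X_1+\cdots+X_\nu$ and $T_\nu=\sum_{j=0}^{X-1}\frac{1}{\nu+j}$ (so $T_\nu=0$ if $X=0$). Then $T_\nu$ is the (almost surely unique) UMVUE of $-\log\theta$, and for every $\theta\in(0,1)$ $$\operatorname{Var}T_\nu=\sum_{k=1}^\infty\frac{(1-\theta)^k}{k^2\binom{\nu+k-1}{k}},$$ whose first term $(1-\theta)/\nu$ is the Cramér–Rao lower bound for unbiased estimators of $-\log\theta$. -/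

import Mathlib

open MeasureTheory ProbabilityTheory

noncomputable section

namespace PearsonUMVUE

/-- `δ` is an unbiased estimator of `g θ` in the statistical model `(P θ)_{θ ∈ Θ}`. -/
structure IsUnbiased {Θ S : Type*} [MeasurableSpace S] (P : Θ → Measure S) (g : Θ → ℝ)
    (δ : S → ℝ) : Prop where
  measurable : Measurable δ
  integrable : ∀ θ, Integrable δ (P θ)
  integral_eq : ∀ θ, ∫ x, δ x ∂(P θ) = g θ

/-- `T` is a uniformly minimum variance unbiased estimator of `g θ`: it is unbiased, has finite
variance for every parameter, and for every parameter its variance is at most that of any other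
unbiased estimator (whose variance, in `[0, ∞]`, is allowed to be infinite). -/
structure IsUMVUE {Θ S : Type*} [MeasurableSpace S] (P : Θ → Measure S) (g : Θ → ℝ)
    (T : S → ℝ) : Prop where
  unbiased : IsUnbiased P g T
  memLp : ∀ θ, MemLp T 2 (P θ)
  minimal : ∀ δ : S → ℝ, IsUnbiased P g δ → ∀ θ, evariance T (P θ) ≤ evariance δ (P θ)

/-- The law of a random sample of size `ν` from `Exp(l)`, with density `l e^{-l x}`, `x > 0`. -/
def expSample (ν : ℕ) (l : ℝ) : Measure (Fin ν → ℝ) :=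
  Measure.pi fun _ => expMeasure l

/-- The law of a random sample of size `ν` from the geometric distribution
`p(x) = θ (1 - θ) ^ x`, `x = 0, 1, …`, with `0 < θ < 1`. -/
def geomSample (ν : ℕ) (θ : Set.Ioo (0 : ℝ) 1) : Measure (Fin ν → ℕ) :=
  Measure.pi fun _ => geometricMeasure ⟨θ.1, θ.2.1.le, θ.2.2.le⟩

/-- `L_ν = - log X - γ + ∑_{j=1}^{ν-1} 1/j`, where `X` is the sample sum. -/
def L (ν : ℕ) (x : Fin ν → ℝ) : ℝ :=
  -Real.log (∑ i, x i) - Real.eulerMascheroniConstant + ∑ j ∈ Finset.Ico 1 ν, 1 / (j : ℝ)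

/-- `T_ν = 1/ν + 1/(ν+1) + ⋯ + 1/(ν+X-1)` (`0` if `X = 0`), where `X` is the sample sum. -/
def T (ν : ℕ) (x : Fin ν → ℕ) : ℝ :=
  ∑ j ∈ Finset.range (∑ i, x i), 1 / ((ν : ℝ) + j)

/-- The Fisher information at `t`, in one observation, of the family of densities `p t` with
respect to the reference measure `μ`. -/
def fisherInformation {S : Type*} [MeasurableSpace S] (μ : Measure S) (p : ℝ → S → ℝ)
    (t : ℝ) : ℝ :=
  ∫ x, (deriv (fun s => Real.log (p s x)) t) ^ 2 * p t x ∂μ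

/-- The Cramér–Rao lower bound at `t` for the variance of unbiased estimators of `g t` based on a
random sample of size `ν` from the density `p t` with respect to `μ`. -/
def cramerRaoBound {S : Type*} [MeasurableSpace S] (μ : Measure S) (p : ℝ → S → ℝ)
    (g : ℝ → ℝ) (ν : ℕ) (t : ℝ) : ℝ :=
  (deriv g t) ^ 2 / (ν * fisherInformation μ p t)

end PearsonUMVUE

end

/-!
Both models are exponential families whose sufficient statistic is the sample sum `X`. Such a
family is complete: if `U` has mean `0` throughout, the laws of `X` under the positive and the
negative part of `U` have the same moment generating function near `0`, which by analyticity
determines them, so `E[U | X] = 0`. Hence every square-integrable function of `X` is uncorrelated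
with all unbiased estimators of `0`, and is the unique UMVUE of its mean.

For exponential samples `X` is Gamma distributed, and `log X` has cumulant generating function
`t ↦ log Γ(a + t) - log Γ(a) - t log l` with `a = ν`. Its variance `V(a)` satisfies
`V(a + 1) = V(a) - 1 / a ^ 2` and `V(a) ≤ 1 / (a - 1)`, so it telescopes to `∑ 1 / (a + k) ^ 2`.

For geometric samples `X` is negative binomial, and the expectation of `f(X)` is
`(1 - q) ^ ν ∑ n, (n + ν - 1).choose n * f n * q ^ n` with `q = 1 - θ`. Up to the factor
`(1 - q) ^ (-ν)`, the series for `T` and `T ^ 2` satisfy first-order linear differential equations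
with the solutions `-log (1 - q)` and `log (1 - q) ^ 2 + ∑ q ^ k / (k ^ 2 * (ν + k - 1).choose k)`.
-/

namespace PearsonUMVUE

open Filter Topology

section Completeness

variable {S : Type*} [MeasurableSpace S] {μ : Measure S} {U g X : S → ℝ}

open Complex in
theorem map_eq_map_of_mgf_eventuallyEq {S' : Type*} [MeasurableSpace S'] {μ' : Measure S'}
    [IsFiniteMeasure μ] [IsFiniteMeasure μ'] {Y : S' → ℝ}
    (hX : 0 ∈ interior (integrableExpSet X μ)) (hY : 0 ∈ interior (integrableExpSet Y μ'))
    (h : mgf X μ =ᶠ[𝓝 0] mgf Y μ') : μ.map X = μ'.map Y := by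
  set strip : Set ℂ :=
    {z | z.re ∈ interior (integrableExpSet X μ) ∩ interior (integrableExpSet Y μ')}
  have hstrip : IsPreconnected strip :=
    ((convex_integrableExpSet.interior.inter convex_integrableExpSet.interior).linear_preimage
      reLm).isPreconnected
  have hzero : ((0 : ℝ) : ℂ) ∈ strip := ⟨by simpa using hX, by simpa using hY⟩
  have hfreq : ∃ᶠ z in 𝓝[≠] ((0 : ℝ) : ℂ), complexMGF X μ z = complexMGF Y μ' z := by
    have hto : Tendsto ((↑) : ℝ → ℂ) (𝓝[≠] 0) (𝓝[≠] ((0 : ℝ) : ℂ)) :=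
      tendsto_nhdsWithin_iff.2 ⟨(continuous_ofReal.tendsto 0).mono_left nhdsWithin_le_nhds,
        by filter_upwards [self_mem_nhdsWithin] with t ht using by simpa using ht⟩
    refine hto.frequently (Eventually.frequently ?_)
    filter_upwards [h.filter_mono nhdsWithin_le_nhds] with t ht
    rw [complexMGF_ofReal, complexMGF_ofReal, ht]
  have hEq : Set.EqOn (complexMGF X μ) (complexMGF Y μ') strip :=
    AnalyticOnNhd.eqOn_of_preconnected_of_frequently_eq
      (analyticOnNhd_complexMGF.mono fun _ hz => hz.1)
      (analyticOnNhd_complexMGF.mono fun _ hz => hz.2) hstrip hzero hfreq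
  refine Measure.ext_of_charFun (funext fun t => ?_)
  rw [← complexMGF_mul_I (aemeasurable_of_mem_interior_integrableExpSet hX),
    ← complexMGF_mul_I (aemeasurable_of_mem_interior_integrableExpSet hY)]
  exact hEq ⟨by simpa using hX, by simpa using hY⟩

theorem integrable_max_zero_mul (hU : AEStronglyMeasurable U μ) (hg : AEStronglyMeasurable g μ)
    (h : Integrable (fun x => U x * g x) μ) : Integrable (fun x => max (U x) 0 * g x) μ := by
  refine h.mono (by fun_prop) (ae_of_all _ fun x => ?_)
  rw [norm_mul, norm_mul]
  gcongr
  exact abs_max_le_max_abs_abs.trans (by simp)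

theorem integrable_withDensity_ofReal (hU : Measurable U) (hg : AEStronglyMeasurable g μ)
    (h : Integrable (fun x => U x * g x) μ) :
    Integrable g (μ.withDensity fun x => ENNReal.ofReal (U x)) := by
  rw [integrable_withDensity_iff_integrable_smul' (by fun_prop) (by simp)]
  simpa [ENNReal.toReal_ofReal'] using
    integrable_max_zero_mul hU.aestronglyMeasurable hg h

theorem integral_withDensity_ofReal_sub_neg (hU : Measurable U) (hg : AEStronglyMeasurable g μ)
    (h : Integrable (fun x => U x * g x) μ) :
    ∫ x, g x ∂(μ.withDensity fun x => ENNReal.ofReal (U x)) -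
      ∫ x, g x ∂(μ.withDensity fun x => ENNReal.ofReal (-U x)) = ∫ x, U x * g x ∂μ := by
  have hV : Measurable fun x => -U x := hU.neg
  rw [integral_withDensity_eq_integral_toReal_smul (by fun_prop) (by simp),
    integral_withDensity_eq_integral_toReal_smul (by fun_prop) (by simp)]
  simp only [ENNReal.toReal_ofReal', smul_eq_mul]
  rw [← integral_sub (integrable_max_zero_mul hU.aestronglyMeasurable hg h)
    (integrable_max_zero_mul hV.aestronglyMeasurable hg (by simpa using h.neg))]
  simp only [← sub_mul, max_zero_sub_max_neg_zero_eq_self]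

theorem condExp_comap_eq_zero_of_integral_mul_exp_eq_zero [IsFiniteMeasure μ] (hX : Measurable X)
    (hU : Measurable U)
    (h : ∀ᶠ t in 𝓝 (0 : ℝ), Integrable (fun x => U x * Real.exp (t * X x)) μ ∧
      ∫ x, U x * Real.exp (t * X x) ∂μ = 0) :
    μ[U | MeasurableSpace.comap X inferInstance] =ᵐ[μ] 0 := by
  set μpos := μ.withDensity fun x => ENNReal.ofReal (U x) with hμpos
  set μneg := μ.withDensity fun x => ENNReal.ofReal (-U x) with hμneg
  have hUi : Integrable U μ := by simpa using h.self_of_nhds.1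
  have : IsFiniteMeasure μpos := isFiniteMeasure_withDensity_ofReal hUi.2
  have : IsFiniteMeasure μneg := isFiniteMeasure_withDensity_ofReal hUi.neg.2
  have hlaw : μpos.map X = μneg.map X := by
    refine map_eq_map_of_mgf_eventuallyEq ?_ ?_ ?_
    · rw [mem_interior_iff_mem_nhds]
      filter_upwards [h] with t ht
      exact integrable_withDensity_ofReal hU (by fun_prop) ht.1
    · rw [mem_interior_iff_mem_nhds]
      filter_upwards [h] with t ht
      exact integrable_withDensity_ofReal hU.neg (by fun_prop) (by simpa using ht.1.neg)
    · filter_upwards [h] with t ht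
      exact sub_eq_zero.1
        ((integral_withDensity_ofReal_sub_neg hU (by fun_prop) ht.1).trans ht.2)
  refine (ae_eq_condExp_of_forall_setIntegral_eq hX.comap_le hUi
    (fun _ _ _ => integrableOn_zero) ?_ aestronglyMeasurable_zero).symm
  rintro _ ⟨B, hB, rfl⟩ -
  have hpre := hX hB
  have hmul : (fun x => U x * (X ⁻¹' B).indicator (1 : S → ℝ) x) = (X ⁻¹' B).indicator U := by
    ext x
    by_cases hx : x ∈ X ⁻¹' B <;> simp [hx]
  have hparts := integral_withDensity_ofReal_sub_neg hU
    (g := (X ⁻¹' B).indicator 1) (aestronglyMeasurable_one.indicator hpre)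
    (by simpa only [hmul] using hUi.indicator hpre)
  have hreal : μpos.real (X ⁻¹' B) = μneg.real (X ⁻¹' B) := by
    rw [← map_measureReal_apply hX hB, hlaw, map_measureReal_apply hX hB]
  rw [integral_indicator_one hpre, integral_indicator_one hpre, ← hμpos, ← hμneg, hreal,
    sub_self, hmul, integral_indicator hpre] at hparts
  simpa using hparts

end Completeness

section ExponentialFamily

variable {Θ S : Type*} [MeasurableSpace S]

/-- `P` is an exponential family with sufficient statistic `X`: close to each of its members it
contains all the exponential tilts by `X`, i.e. its natural parameter ranges over an open set. -/
structure IsExpFamily (P : Θ → Measure S) (X : S → ℝ) : Prop where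
  isProbabilityMeasure : ∀ θ, IsProbabilityMeasure (P θ)
  measurable : Measurable X
  tilt : ∀ θ, ∀ᶠ t in 𝓝 (0 : ℝ), ∃ θ', P θ' = (P θ).tilted (t * X ·)

theorem IsUnbiased.sub {P : Θ → Measure S} {g g' : Θ → ℝ} {δ δ' : S → ℝ} (h : IsUnbiased P g δ)
    (h' : IsUnbiased P g' δ') : IsUnbiased P (g - g') (δ - δ') where
  measurable := h.measurable.sub h'.measurable
  integrable θ := (h.integrable θ).sub (h'.integrable θ)
  integral_eq θ := by
    simp only [Pi.sub_apply]
    rw [integral_sub (h.integrable θ) (h'.integrable θ), h.integral_eq, h'.integral_eq]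

theorem IsUnbiased.comp {S' : Type*} [MeasurableSpace S'] {P : Θ → Measure S}
    {ρ : Θ → Measure S'} {Y : S → S'} {g : Θ → ℝ} {f : S' → ℝ} (hf : IsUnbiased ρ g f)
    (hY : Measurable Y) (hmap : ∀ θ, (P θ).map Y = ρ θ) : IsUnbiased P g (f ∘ Y) where
  measurable := hf.measurable.comp hY
  integrable θ := by
    have hint := hf.integrable θ
    rw [← hmap θ] at hint
    exact hint.comp_measurable hY
  integral_eq θ := by
    rw [← hf.integral_eq θ, ← hmap θ,
      integral_map hY.aemeasurable hf.measurable.aestronglyMeasurable]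
    rfl

namespace IsExpFamily

variable {P : Θ → Measure S} {X T U δ : S → ℝ} {g : Θ → ℝ}

theorem condExp_eq_zero (h : IsExpFamily P X) (hU : IsUnbiased P 0 U) (θ : Θ) :
    (P θ)[U | MeasurableSpace.comap X inferInstance] =ᵐ[P θ] 0 := by
  have := h.isProbabilityMeasure
  refine condExp_comap_eq_zero_of_integral_mul_exp_eq_zero h.measurable hU.measurable ?_
  filter_upwards [h.tilt θ] with t ⟨θ', hθ'⟩
  have hexp : Integrable (fun x => Real.exp (t * X x)) (P θ) := by
    by_contra hnot
    exact IsProbabilityMeasure.ne_zero (P θ') (hθ'.trans (tilted_of_not_integrable hnot))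
  have hint := hU.integrable θ'
  have hzero := hU.integral_eq θ'
  rw [hθ', integrable_tilted_iff hexp] at hint
  rw [hθ', integral_tilted_mul_eq_mgf] at hzero
  simp only [smul_eq_mul, div_mul_eq_mul_div, integral_div, Pi.zero_apply,
    div_eq_zero_iff, (mgf_pos hexp).ne', or_false] at hint hzero
  simpa only [mul_comm (U _)] using And.intro hint hzero

theorem condExp_ae_eq (h : IsExpFamily P X)
    (hTX : Measurable[MeasurableSpace.comap X inferInstance] T) (hT : IsUnbiased P g T)
    (hδ : IsUnbiased P g δ) (θ : Θ) :
    (P θ)[δ | MeasurableSpace.comap X inferInstance] =ᵐ[P θ] T := by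
  have := h.isProbabilityMeasure θ
  have hzero := h.condExp_eq_zero (by simpa using hδ.sub hT) θ
  have hsub := condExp_sub (hδ.integrable θ) (hT.integrable θ)
    (MeasurableSpace.comap X inferInstance)
  rw [condExp_of_stronglyMeasurable h.measurable.comap_le hTX.stronglyMeasurable
    (hT.integrable θ)] at hsub
  filter_upwards [hzero, hsub] with x hx hx'
  simpa [sub_eq_zero, hx] using hx'.symm

theorem covariance_eq_zero (h : IsExpFamily P X)
    (hTX : Measurable[MeasurableSpace.comap X inferInstance] T) (hU : IsUnbiased P 0 U) {θ : Θ}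
    (hT2 : MemLp T 2 (P θ)) (hU2 : MemLp U 2 (P θ)) : cov[T, U; P θ] = 0 := by
  have := h.isProbabilityMeasure θ
  have hpull := condExp_mul_of_stronglyMeasurable_left hTX.stronglyMeasurable
    (hT2.integrable_mul hU2) (hU.integrable θ)
  rw [covariance_eq_sub hT2 hU2, hU.integral_eq θ, Pi.zero_apply, mul_zero, sub_zero,
    ← integral_condExp h.measurable.comap_le]
  refine integral_eq_zero_of_ae ?_
  filter_upwards [hpull, h.condExp_eq_zero hU θ] with x hx hx'
  simp [hx, hx']

theorem variance_eq_add (h : IsExpFamily P X)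
    (hTX : Measurable[MeasurableSpace.comap X inferInstance] T) (hT : IsUnbiased P g T)
    (hδ : IsUnbiased P g δ) {θ : Θ} (hT2 : MemLp T 2 (P θ)) (hδ2 : MemLp δ 2 (P θ)) :
    variance δ (P θ) = variance T (P θ) + variance (δ - T) (P θ) := by
  have := h.isProbabilityMeasure θ
  have hcov := h.covariance_eq_zero hTX (by simpa using hδ.sub hT) hT2 (hδ2.sub hT2)
  have hadd := variance_add hT2 (hδ2.sub hT2)
  rwa [add_sub_cancel, hcov, mul_zero, add_zero] at hadd

/-- The Lehmann–Scheffé theorem. -/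
theorem isUMVUE (h : IsExpFamily P X)
    (hTX : Measurable[MeasurableSpace.comap X inferInstance] T) (hT : IsUnbiased P g T)
    (hT2 : ∀ θ, MemLp T 2 (P θ)) : IsUMVUE P g T where
  unbiased := hT
  memLp := hT2
  minimal δ hδ θ := by
    have := h.isProbabilityMeasure θ
    by_cases hδ2 : MemLp δ 2 (P θ)
    · rw [← ofReal_variance (hT2 θ), ← ofReal_variance hδ2,
        h.variance_eq_add hTX hT hδ (hT2 θ) hδ2]
      exact ENNReal.ofReal_le_ofReal (le_add_of_nonneg_right (variance_nonneg _ _))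
    · rw [evariance_eq_top hδ.measurable.aestronglyMeasurable hδ2]
      exact le_top

theorem ae_eq_of_isUMVUE (h : IsExpFamily P X)
    (hTX : Measurable[MeasurableSpace.comap X inferInstance] T) (hT : IsUMVUE P g T)
    (hδ : IsUMVUE P g δ) (θ : Θ) : δ =ᵐ[P θ] T := by
  have := h.isProbabilityMeasure θ
  have hle : variance δ (P θ) ≤ variance T (P θ) := by
    rw [← ENNReal.ofReal_le_ofReal_iff (variance_nonneg _ _), ofReal_variance (hδ.memLp θ),
      ofReal_variance (hT.memLp θ)]
    exact hδ.minimal _ hT.unbiased θ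
  have hadd := h.variance_eq_add hTX hT.unbiased hδ.unbiased (hT.memLp θ) (hδ.memLp θ)
  have hzero : variance (δ - T) (P θ) = 0 := by
    linarith [variance_nonneg (δ - T) (P θ)]
  filter_upwards [ae_eq_integral_of_variance_eq_zero ((hδ.memLp θ).sub (hT.memLp θ)) hzero]
    with x hx
  rw [(hδ.unbiased.sub hT.unbiased).integral_eq θ] at hx
  simpa [sub_eq_zero] using hx

end IsExpFamily

end ExponentialFamily

section Sample

variable {ι : Type*} [Fintype ι] {S : ι → Type*} [∀ i, MeasurableSpace (S i)]
  {μ : ∀ i, Measure (S i)}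

theorem pi_tilted [∀ i, IsFiniteMeasure (μ i)] (f : ∀ i, S i → ℝ) :
    Measure.pi (fun i => (μ i).tilted (f i)) =
      (Measure.pi μ).tilted (fun x => ∑ i, f i (x i)) := by
  refine Measure.pi_eq fun s hs => ?_
  simp_rw [tilted_apply_eq_ofReal_integral' _ (MeasurableSet.univ_pi hs),
    tilted_apply_eq_ofReal_integral' _ (hs _), Measure.restrict_pi_pi, Real.exp_sum,
    integral_fintype_prod_eq_prod (fun i y => Real.exp (f i y)), ← Finset.prod_div_distrib,
    integral_fintype_prod_eq_prod (fun i y => Real.exp (f i y) / ∫ z, Real.exp (f i z) ∂μ i)]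
  exact ENNReal.ofReal_prod_of_nonneg fun i _ => by positivity

theorem mgf_sum_pi [∀ i, SigmaFinite (μ i)] (X : ∀ i, S i → ℝ) (t : ℝ) :
    mgf (fun x => ∑ i, X i (x i)) (Measure.pi μ) t = ∏ i, mgf (X i) (μ i) t := by
  simp_rw [mgf, Finset.mul_sum, Real.exp_sum]
  exact integral_fintype_prod_eq_prod fun i y => Real.exp (t * X i y)

theorem integrable_exp_mul_sum_pi [∀ i, SigmaFinite (μ i)] {X : ∀ i, S i → ℝ} {t : ℝ}
    (h : ∀ i, Integrable (fun y => Real.exp (t * X i y)) (μ i)) :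
    Integrable (fun x => Real.exp (t * ∑ i, X i (x i))) (Measure.pi μ) := by
  simp_rw [Finset.mul_sum, Real.exp_sum]
  exact Integrable.fintype_prod_dep h

theorem map_sum_pi_eq_of_mgf [∀ i, IsFiniteMeasure (μ i)] {S' : Type*} [MeasurableSpace S']
    {ρ : Measure S'} [IsFiniteMeasure ρ] {X : ∀ i, S i → ℝ} {Y : S' → ℝ}
    (hX : ∀ i, 0 ∈ interior (integrableExpSet (X i) (μ i)))
    (hY : 0 ∈ interior (integrableExpSet Y ρ))
    (h : ∀ᶠ t in 𝓝 0, ∏ i, mgf (X i) (μ i) t = mgf Y ρ t) :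
    (Measure.pi μ).map (fun x => ∑ i, X i (x i)) = ρ.map Y := by
  refine map_eq_map_of_mgf_eventuallyEq ?_ hY ?_
  · simp_rw [mem_interior_iff_mem_nhds] at hX ⊢
    filter_upwards [eventually_all.2 hX] with t ht
    exact integrable_exp_mul_sum_pi ht
  · filter_upwards [h] with t ht
    rw [mgf_sum_pi, ht]

theorem IsExpFamily.pi {Θ S : Type*} [MeasurableSpace S] {P : Θ → Measure S} {X : S → ℝ}
    (h : IsExpFamily P X) :
    IsExpFamily (fun θ => Measure.pi fun _ : ι => P θ) (fun x => ∑ i, X (x i)) where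
  isProbabilityMeasure θ := by
    have := h.isProbabilityMeasure θ
    infer_instance
  measurable := by
    have := h.measurable
    fun_prop
  tilt θ := by
    have := h.isProbabilityMeasure θ
    filter_upwards [h.tilt θ] with t ⟨θ', hθ'⟩
    refine ⟨θ', ?_⟩
    simp_rw [hθ', pi_tilted, Finset.mul_sum]

end Sample

section Cumulant

variable {S : Type*} [MeasurableSpace S] {μ : Measure S} {X : S → ℝ} {K K' : ℝ → ℝ} {v : ℝ}

theorem integral_exp_of_eq_withDensity {ρ : Measure S} [IsProbabilityMeasure ρ] {f : S → ℝ}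
    {M : ℝ} (hM : 0 < M) (hf : AEMeasurable f μ)
    (h : ρ = μ.withDensity fun x => ENNReal.ofReal (Real.exp (f x) / M)) :
    Integrable (fun x => Real.exp (f x)) μ ∧ ∫ x, Real.exp (f x) ∂μ = M := by
  have hone : ∫⁻ x, ENNReal.ofReal (Real.exp (f x) / M) ∂μ = 1 := by
    rw [← setLIntegral_univ, ← withDensity_apply _ MeasurableSet.univ, ← h, measure_univ]
  have hint : Integrable (fun x => Real.exp (f x) / M) μ :=
    ⟨by fun_prop, (hasFiniteIntegral_iff_ofReal (ae_of_all _ fun x => by positivity)).2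
      (by simp [hone])⟩
  have hdiv : ∫ x, Real.exp (f x) / M ∂μ = 1 := by
    rw [integral_eq_lintegral_of_nonneg_ae (ae_of_all _ fun x => by positivity) hint.1, hone,
      ENNReal.toReal_one]
  refine ⟨by simpa [hM.ne'] using hint.mul_const M, ?_⟩
  rwa [integral_div, div_eq_one_iff_eq hM.ne'] at hdiv

theorem eq_tilted_of_eq_withDensity {ρ : Measure S} [IsProbabilityMeasure ρ] {f : S → ℝ}
    {M : ℝ} (hM : 0 < M) (hf : AEMeasurable f μ)
    (h : ρ = μ.withDensity fun x => ENNReal.ofReal (Real.exp (f x) / M)) : ρ = μ.tilted f := by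
  rw [Measure.tilted, (integral_exp_of_eq_withDensity hM hf h).2, h]

theorem hasDerivAt_deriv_cgf_zero [IsProbabilityMeasure μ]
    (h : 0 ∈ interior (integrableExpSet X μ)) :
    HasDerivAt (deriv (cgf X μ)) (variance X μ) 0 := by
  have hvar := variance_tilted_mul h
  simp only [zero_mul, tilted_const, iteratedDeriv_succ, iteratedDeriv_zero] at hvar
  rw [hvar]
  exact (analyticAt_cgf h).deriv.differentiableAt.hasDerivAt

theorem integral_eq_of_cgf_eventuallyEq [IsProbabilityMeasure μ]
    (h : 0 ∈ interior (integrableExpSet X μ)) (hK : cgf X μ =ᶠ[𝓝 0] K) (hK' : HasDerivAt K v 0) :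
    ∫ x, X x ∂μ = v := by
  have hmean := deriv_cgf_zero h
  simp only [probReal_univ, div_one] at hmean
  rw [← hmean, hK.deriv_eq, hK'.deriv]

theorem variance_eq_of_cgf_eventuallyEq [IsProbabilityMeasure μ]
    (h : 0 ∈ interior (integrableExpSet X μ)) (hK : cgf X μ =ᶠ[𝓝 0] K)
    (hK' : ∀ᶠ t in 𝓝 0, HasDerivAt K (K' t) t) (hK'' : HasDerivAt K' v 0) :
    variance X μ = v := by
  have hderiv : deriv (cgf X μ) =ᶠ[𝓝 0] K' := by
    filter_upwards [hK.deriv, hK'] with t ht ht'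
    rw [ht, ht'.deriv]
  exact (hasDerivAt_deriv_cgf_zero h).unique (hK''.congr_of_eventuallyEq hderiv)

theorem one_add_sq_div_two_le_cosh (y : ℝ) : 1 + y ^ 2 / 2 ≤ Real.cosh y := by
  have hpartial := sum_le_hasSum (Finset.range 2)
    (fun n _ => by rw [pow_mul]; positivity) (Real.hasSum_cosh y)
  simpa [Finset.sum_range_succ] using hpartial

theorem variance_le_mgf_one_mul_mgf_neg_one_sub_one [IsProbabilityMeasure μ]
    (h : 1 ∈ integrableExpSet X μ) (h' : -1 ∈ integrableExpSet X μ) :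
    variance X μ ≤ mgf X μ 1 * mgf X μ (-1) - 1 := by
  have hX : AEStronglyMeasurable X μ :=
    (aemeasurable_of_integrable_exp_mul (by norm_num) h h').aestronglyMeasurable
  set c := Real.log (mgf X μ 1)
  have hc : Real.exp c = mgf X μ 1 := Real.exp_log (mgf_pos h)
  have hcosh (x : S) : 2 * Real.cosh (X x - c) - 2 =
      (mgf X μ 1)⁻¹ * Real.exp (1 * X x) + mgf X μ 1 * Real.exp (-1 * X x) - 2 := by
    rw [Real.cosh_eq, neg_sub, Real.exp_sub, Real.exp_sub, neg_one_mul, Real.exp_neg, one_mul, hc]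
    ring
  have hint : Integrable (fun x => (mgf X μ 1)⁻¹ * Real.exp (1 * X x) +
      mgf X μ 1 * Real.exp (-1 * X x)) μ := (h.const_mul _).add (h'.const_mul _)
  calc variance X μ = variance (fun x => X x - c) μ := (variance_sub_const hX c).symm
    _ ≤ ∫ x, (X x - c) ^ 2 ∂μ := variance_le_expectation_sq (hX.sub aestronglyMeasurable_const)
    _ ≤ ∫ x, (2 * Real.cosh (X x - c) - 2) ∂μ := by
      refine integral_mono_of_nonneg (ae_of_all _ fun x => sq_nonneg _) ?_
        (ae_of_all _ fun x => by linarith [one_add_sq_div_two_le_cosh (X x - c)])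
      simp only [hcosh]
      exact hint.sub (integrable_const 2)
    _ = mgf X μ 1 * mgf X μ (-1) - 1 := by
      simp only [hcosh]
      rw [integral_sub hint (integrable_const 2),
        integral_add (h.const_mul _) (h'.const_mul _),
        integral_const_mul, integral_const_mul, ← mgf, ← mgf, inv_mul_cancel₀ (mgf_pos h).ne']
      simp only [integral_const, probReal_univ, smul_eq_mul, one_mul]
      ring

end Cumulant

section Gamma

variable {a r t : ℝ}

theorem gammaMeasure_eq_withDensity_exp_div {b q M : ℝ} {f : ℝ → ℝ} (ha : 0 < a) (hr : 0 < r)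
    (hf : Measurable f)
    (h : ∀ x, 0 < x → gammaPDFReal b q x = gammaPDFReal a r x * (Real.exp (f x) / M)) :
    gammaMeasure b q =
      (gammaMeasure a r).withDensity fun x => ENNReal.ofReal (Real.exp (f x) / M) := by
  have hpdf : Measurable (gammaPDF a r) := (measurable_gammaPDFReal a r).ennreal_ofReal
  rw [gammaMeasure, gammaMeasure, ← withDensity_mul _ hpdf (by fun_prop)]
  refine withDensity_congr_ae ?_
  filter_upwards [Measure.ae_ne volume (0 : ℝ)] with x hx
  rcases hx.lt_or_gt with hneg | hpos
  · simp [gammaPDF_of_neg hneg]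
  · rw [Pi.mul_apply, gammaPDF, gammaPDF, h x hpos,
      ENNReal.ofReal_mul (gammaPDFReal_nonneg ha hr x)]

theorem gammaMeasure_sub_eq_withDensity (ha : 0 < a) (hr : 0 < r) (ht : t < r) :
    gammaMeasure a (r - t) = (gammaMeasure a r).withDensity
      fun x => ENNReal.ofReal (Real.exp (t * x) / (r / (r - t)) ^ a) := by
  have hrt := sub_pos.2 ht
  refine gammaMeasure_eq_withDensity_exp_div ha hr (by fun_prop) fun x hx => ?_
  rw [gammaPDFReal, gammaPDFReal, if_pos hx.le, if_pos hx.le, Real.div_rpow hr.le hrt.le,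
    show -((r - t) * x) = -(r * x) + t * x by ring, Real.exp_add]
  have := Real.rpow_pos_of_pos hr a
  field_simp

theorem gammaMeasure_add_eq_withDensity (ha : 0 < a) (hr : 0 < r) (ht : 0 < a + t) :
    gammaMeasure (a + t) r = (gammaMeasure a r).withDensity fun x => ENNReal.ofReal
      (Real.exp (t * Real.log x) / (Real.Gamma (a + t) / Real.Gamma a * r ^ (-t))) := by
  refine gammaMeasure_eq_withDensity_exp_div ha hr (by fun_prop) fun x hx => ?_
  rw [gammaPDFReal, gammaPDFReal, if_pos hx.le, if_pos hx.le, Real.rpow_add hr,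
    show a + t - 1 = (a - 1) + t by ring, Real.rpow_add hx, Real.rpow_def_of_pos hx t,
    mul_comm (Real.log x) t, Real.rpow_neg hr.le]
  have := Real.Gamma_pos_of_pos ha
  field_simp

theorem tilted_gammaMeasure (ha : 0 < a) (hr : 0 < r) (ht : t < r) :
    (gammaMeasure a r).tilted (t * ·) = gammaMeasure a (r - t) := by
  have hrt := sub_pos.2 ht
  have := isProbabilityMeasure_gammaMeasure ha hrt
  exact (eq_tilted_of_eq_withDensity (by positivity) (by fun_prop)
    (gammaMeasure_sub_eq_withDensity ha hr ht)).symm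

theorem integrable_exp_and_mgf_id_gammaMeasure (ha : 0 < a) (hr : 0 < r) (ht : t < r) :
    Integrable (fun x => Real.exp (t * x)) (gammaMeasure a r) ∧
      mgf id (gammaMeasure a r) t = (r / (r - t)) ^ a := by
  have hrt := sub_pos.2 ht
  have := isProbabilityMeasure_gammaMeasure ha hrt
  exact integral_exp_of_eq_withDensity (by positivity) (by fun_prop)
    (gammaMeasure_sub_eq_withDensity ha hr ht)

theorem integrable_exp_and_mgf_log_gammaMeasure (ha : 0 < a) (hr : 0 < r) (ht : 0 < a + t) :
    Integrable (fun x => Real.exp (t * Real.log x)) (gammaMeasure a r) ∧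
      mgf Real.log (gammaMeasure a r) t = Real.Gamma (a + t) / Real.Gamma a * r ^ (-t) := by
  have := isProbabilityMeasure_gammaMeasure ht hr
  have := Real.Gamma_pos_of_pos ha
  have := Real.Gamma_pos_of_pos ht
  exact integral_exp_of_eq_withDensity (by positivity) (by fun_prop)
    (gammaMeasure_add_eq_withDensity ha hr ht)

theorem zero_mem_interior_integrableExpSet_id_gammaMeasure (ha : 0 < a) (hr : 0 < r) :
    0 ∈ interior (integrableExpSet id (gammaMeasure a r)) := by
  rw [mem_interior_iff_mem_nhds]
  filter_upwards [Iio_mem_nhds hr] with t ht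
  exact (integrable_exp_and_mgf_id_gammaMeasure ha hr ht).1

theorem zero_mem_interior_integrableExpSet_log_gammaMeasure (ha : 0 < a) (hr : 0 < r) :
    0 ∈ interior (integrableExpSet Real.log (gammaMeasure a r)) := by
  rw [mem_interior_iff_mem_nhds]
  filter_upwards [Ioi_mem_nhds (neg_neg_of_pos ha)] with t ht
  exact (integrable_exp_and_mgf_log_gammaMeasure ha hr (neg_lt_iff_pos_add'.1 ht)).1

theorem cgf_id_gammaMeasure (ha : 0 < a) (hr : 0 < r) (ht : t < r) :
    cgf id (gammaMeasure a r) t = a * (Real.log r - Real.log (r - t)) := by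
  have hrt := sub_pos.2 ht
  rw [cgf, (integrable_exp_and_mgf_id_gammaMeasure ha hr ht).2, Real.log_rpow (by positivity),
    Real.log_div hr.ne' hrt.ne']

theorem integral_id_gammaMeasure (ha : 0 < a) (hr : 0 < r) :
    ∫ x, x ∂(gammaMeasure a r) = a / r := by
  have := isProbabilityMeasure_gammaMeasure ha hr
  refine integral_eq_of_cgf_eventuallyEq (X := id)
    (K := fun t => a * (Real.log r - Real.log (r - t)))
    (zero_mem_interior_integrableExpSet_id_gammaMeasure ha hr) ?_ ?_
  · filter_upwards [Iio_mem_nhds hr] with t ht using cgf_id_gammaMeasure ha hr ht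
  · convert! ((((hasDerivAt_id (0 : ℝ)).const_sub r).log (by simpa using hr.ne')).const_sub
      (Real.log r)).const_mul a using 1
    simp [div_eq_mul_inv]

theorem variance_id_gammaMeasure (ha : 0 < a) (hr : 0 < r) :
    variance id (gammaMeasure a r) = a / r ^ 2 := by
  have := isProbabilityMeasure_gammaMeasure ha hr
  refine variance_eq_of_cgf_eventuallyEq (K := fun t => a * (Real.log r - Real.log (r - t)))
    (K' := fun t => a / (r - t)) (zero_mem_interior_integrableExpSet_id_gammaMeasure ha hr) ?_ ?_ ?_
  · filter_upwards [Iio_mem_nhds hr] with t ht using cgf_id_gammaMeasure ha hr ht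
  · filter_upwards [Iio_mem_nhds hr] with t ht
    convert! ((((hasDerivAt_id t).const_sub r).log (sub_pos.2 ht).ne').const_sub
      (Real.log r)).const_mul a using 1
    simp [div_eq_mul_inv]
  · convert! (((hasDerivAt_id (0 : ℝ)).const_sub r).inv (by simpa using hr.ne')).const_mul a using 1
    simp [div_eq_mul_inv]

theorem memLp_log_gammaMeasure (ha : 0 < a) (hr : 0 < r) :
    MemLp Real.log 2 (gammaMeasure a r) := by
  exact_mod_cast memLp_of_mem_interior_integrableExpSet
    (zero_mem_interior_integrableExpSet_log_gammaMeasure ha hr) 2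

theorem integral_log_gammaMeasure (ha : 0 < a) (hr : 0 < r) :
    ∫ x, Real.log x ∂(gammaMeasure a r) =
      deriv Real.Gamma a / Real.Gamma a - Real.log r := by
  have := isProbabilityMeasure_gammaMeasure ha hr
  have hGa := Real.Gamma_pos_of_pos ha
  have hΓ : HasDerivAt (fun t => Real.Gamma (a + t)) (deriv Real.Gamma a) 0 := by
    refine HasDerivAt.comp_const_add a 0 ?_
    have hne (m : ℕ) : a + 0 ≠ -m := by
      have : (0 : ℝ) ≤ m := m.cast_nonneg
      linarith
    simpa using (Real.differentiableAt_Gamma hne).hasDerivAt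
  refine integral_eq_of_cgf_eventuallyEq
    (K := fun t => Real.log (Real.Gamma (a + t)) - Real.log (Real.Gamma a) - t * Real.log r)
    (zero_mem_interior_integrableExpSet_log_gammaMeasure ha hr) ?_ ?_
  · filter_upwards [Ioi_mem_nhds (neg_neg_of_pos ha)] with t ht
    have hat : 0 < a + t := by linarith [Set.mem_Ioi.1 ht]
    have hGt := Real.Gamma_pos_of_pos hat
    rw [cgf, (integrable_exp_and_mgf_log_gammaMeasure ha hr hat).2,
      Real.log_mul (by positivity) (by positivity), Real.log_div hGt.ne' hGa.ne', Real.log_rpow hr]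
    ring
  · convert! ((hΓ.log (by simpa using hGa.ne')).sub_const (Real.log (Real.Gamma a))).sub
      ((hasDerivAt_id (0 : ℝ)).mul_const (Real.log r)) using 1
    simp

theorem integral_log_gammaMeasure_nat_add_one (n : ℕ) (hr : 0 < r) :
    ∫ x, Real.log x ∂(gammaMeasure (n + 1) r) =
      harmonic n - Real.eulerMascheroniConstant - Real.log r := by
  rw [integral_log_gammaMeasure (by positivity) hr, Real.deriv_Gamma_nat,
    Real.Gamma_nat_eq_factorial, mul_div_cancel_left₀ _ (by positivity)]
  ring

theorem variance_log_gammaMeasure_add_one (ha : 0 < a) (hr : 0 < r) :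
    variance Real.log (gammaMeasure (a + 1) r) =
      variance Real.log (gammaMeasure a r) - 1 / a ^ 2 := by
  have := isProbabilityMeasure_gammaMeasure ha hr
  have := isProbabilityMeasure_gammaMeasure (add_pos ha one_pos) hr
  have hmem := zero_mem_interior_integrableExpSet_log_gammaMeasure ha hr
  have hpos : ∀ᶠ t in 𝓝 0, 0 < a + t := by
    filter_upwards [Ioi_mem_nhds (neg_neg_of_pos ha)] with t ht using neg_lt_iff_pos_add'.1 ht
  have := Real.Gamma_pos_of_pos ha
  refine variance_eq_of_cgf_eventuallyEq
    (K := fun t => cgf Real.log (gammaMeasure a r) t + (Real.log (a + t) - Real.log a))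
    (K' := fun t => deriv (cgf Real.log (gammaMeasure a r)) t + (a + t)⁻¹)
    (zero_mem_interior_integrableExpSet_log_gammaMeasure (add_pos ha one_pos) hr) ?_ ?_ ?_
  · filter_upwards [hpos] with t ht
    have := Real.Gamma_pos_of_pos ht
    rw [cgf, cgf, (integrable_exp_and_mgf_log_gammaMeasure ha hr ht).2,
      (integrable_exp_and_mgf_log_gammaMeasure (add_pos ha one_pos) hr (by linarith)).2,
      ← Real.log_div ht.ne' ha.ne', ← Real.log_mul (by positivity) (by positivity),
      add_right_comm, Real.Gamma_add_one ht.ne', Real.Gamma_add_one ha.ne']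
    congr 1
    field_simp
  · filter_upwards [hpos, isOpen_interior.mem_nhds hmem] with t ht htmem
    refine (analyticAt_cgf htmem).differentiableAt.hasDerivAt.add ?_
    simpa using (((hasDerivAt_id t).const_add a).log ht.ne').sub_const (Real.log a)
  · convert! (hasDerivAt_deriv_cgf_zero hmem).add
      (((hasDerivAt_id (0 : ℝ)).const_add a).inv (by simpa using ha.ne')) using 1
    simp [sub_eq_add_neg, neg_div]

theorem variance_log_gammaMeasure_le (ha : 1 < a) (hr : 0 < r) :
    variance Real.log (gammaMeasure a r) ≤ 1 / (a - 1) := by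
  have ha0 : 0 < a := by linarith
  have ha1 : 0 < a - 1 := by linarith
  have := isProbabilityMeasure_gammaMeasure ha0 hr
  obtain ⟨hint, hmgf⟩ :=
    integrable_exp_and_mgf_log_gammaMeasure ha0 hr (show 0 < a + 1 by linarith)
  obtain ⟨hint', hmgf'⟩ :=
    integrable_exp_and_mgf_log_gammaMeasure (t := -1) ha0 hr (by linarith)
  have hΓ : Real.Gamma a = (a - 1) * Real.Gamma (a - 1) := by
    rw [← Real.Gamma_add_one ha1.ne', sub_add_cancel]
  refine (variance_le_mgf_one_mul_mgf_neg_one_sub_one hint hint').trans_eq ?_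
  have := Real.Gamma_pos_of_pos ha1
  rw [hmgf, hmgf', Real.Gamma_add_one ha0.ne', ← sub_eq_add_neg, hΓ, neg_neg, Real.rpow_one,
    Real.rpow_neg_one]
  field_simp
  ring

/-- The sum is the trigamma function at `a`. -/
theorem hasSum_variance_log_gammaMeasure (ha : 0 < a) (hr : 0 < r) :
    HasSum (fun k : ℕ => 1 / (a + k) ^ 2) (variance Real.log (gammaMeasure a r)) := by
  set V : ℕ → ℝ := fun n => variance Real.log (gammaMeasure (a + n) r)
  have hpartial (n : ℕ) : ∑ k ∈ Finset.range n, 1 / (a + k) ^ 2 = V 0 - V n := by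
    rw [← Finset.sum_range_sub']
    refine Finset.sum_congr rfl fun k _ => ?_
    have hstep := variance_log_gammaMeasure_add_one (show 0 < a + k by positivity) hr
    simp only [V, Nat.cast_add, Nat.cast_one, ← add_assoc, hstep, sub_sub_cancel]
  have hlim : Tendsto V atTop (𝓝 0) := by
    refine squeeze_zero' (g := fun n : ℕ => 1 / (a + n - 1))
      (.of_forall fun n => variance_nonneg _ _) ?_ ?_
    · filter_upwards [eventually_ge_atTop 1] with n hn
      have : (1 : ℝ) ≤ n := by exact_mod_cast hn
      exact variance_log_gammaMeasure_le (by linarith) hr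
    · refine tendsto_const_nhds.div_atTop ?_
      exact tendsto_atTop_add_const_right _ _
        (tendsto_atTop_add_const_left _ _ tendsto_natCast_atTop_atTop)
  rw [hasSum_iff_tendsto_nat_of_nonneg fun k => by positivity]
  simp only [hpartial]
  simpa only [V, Nat.cast_zero, add_zero, sub_zero] using hlim.const_sub (V 0)

end Gamma

section Series

variable {a V : ℝ} {n : ℕ}

theorem hasSum_sub_succ_of_antitone {e : ℕ → ℝ} (he : Antitone e) (h0 : Tendsto e atTop (𝓝 0)) :
    HasSum (fun k => e k - e (k + 1)) (e 0) := by
  rw [hasSum_iff_tendsto_nat_of_nonneg fun k => sub_nonneg.2 (he k.le_succ)]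
  simp only [Finset.sum_range_sub']
  simpa using h0.const_sub (e 0)

theorem hasSum_one_div_add_mul_add_add_one (ha : 0 < a) :
    HasSum (fun k : ℕ => 1 / ((a + k) * (a + k + 1))) (1 / a) := by
  have hanti : Antitone fun k : ℕ => 1 / (a + k) := fun i j hij => by
    dsimp only
    gcongr
  have hlim : Tendsto (fun k : ℕ => 1 / (a + k)) atTop (𝓝 0) :=
    tendsto_const_nhds.div_atTop
      (tendsto_atTop_add_const_left _ _ tendsto_natCast_atTop_atTop)
  have h := hasSum_sub_succ_of_antitone hanti hlim
  simp only [Nat.cast_zero, add_zero] at h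
  refine h.congr_fun fun k => ?_
  push_cast
  field_simp
  ring

theorem one_lt_mul_of_hasSum_one_div_add_sq (ha : 0 < a)
    (hV : HasSum (fun k : ℕ => 1 / (a + k) ^ 2) V) : 1 < a * V := by
  have hlt (k : ℕ) : 1 / ((a + k) * (a + k + 1)) < 1 / (a + k) ^ 2 := by
    have : 0 < a + k := by positivity
    apply one_div_lt_one_div_of_lt (by positivity)
    nlinarith
  have := hasSum_lt (fun k => (hlt k).le) (hlt 0) (hasSum_one_div_add_mul_add_add_one ha) hV
  rwa [div_lt_iff₀' ha] at this

theorem mul_lt_of_hasSum_one_div_add_sq (ha : 0 < a)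
    (hV : HasSum (fun k : ℕ => 1 / (a + k) ^ 2) V) : a * V < 1 + 1 / a := by
  have htail := (hasSum_nat_add_iff' 1).2 hV
  have hlt (k : ℕ) : 1 / (a + (k + 1 : ℕ)) ^ 2 < 1 / ((a + k) * (a + k + 1)) := by
    have : 0 < a + k := by positivity
    apply one_div_lt_one_div_of_lt (by positivity)
    push_cast
    nlinarith
  have hlt' := hasSum_lt (fun k => (hlt k).le) (hlt 0) htail (hasSum_one_div_add_mul_add_add_one ha)
  simp only [Finset.range_one, Finset.sum_singleton, Nat.cast_zero, add_zero,
    sub_lt_iff_lt_add'] at hlt'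
  calc a * V < a * (1 / a ^ 2 + 1 / a) := by gcongr
    _ = 1 + 1 / a := by
      field_simp
      ring

theorem hasSum_one_div_nat_add_sq (hn : 1 ≤ n) :
    HasSum (fun k : ℕ => 1 / ((n : ℝ) + k) ^ 2)
      (Real.pi ^ 2 / 6 - ∑ j ∈ Finset.Ico 1 n, 1 / (j : ℝ) ^ 2) := by
  have htail := (hasSum_nat_add_iff' n).2 hasSum_zeta_two
  rw [Finset.range_eq_Ico, Finset.sum_eq_sum_Ico_succ_bot hn] at htail
  simpa [add_comm] using htail

theorem cast_add_choose_succ_mul (n k : ℕ) :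
    ((n + k).choose (k + 1) : ℝ) * (k + 1) = n * (n + k).choose k := by
  have := Nat.choose_succ_right_eq (n + k) k
  rw [Nat.add_sub_cancel] at this
  rw [mul_comm (n : ℝ)]
  exact_mod_cast this

theorem cast_add_add_one_choose_mul (n k : ℕ) :
    ((n + 1 + k).choose k : ℝ) * (n + 1) = (n + k + 1) * (n + k).choose k := by
  have := Nat.choose_mul_succ_eq (n + k) k
  rw [show n + k + 1 - k = n + 1 by lia, show n + k + 1 = n + 1 + k by ring] at this
  rw [mul_comm ((n : ℝ) + k + 1), add_right_comm (n : ℝ)]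
  exact_mod_cast this.symm

theorem one_div_sq_mul_choose_sub (hn : 1 ≤ n) (k : ℕ) :
    1 / (((k : ℝ) + 1) ^ 2 * (n + k).choose (k + 1)) -
        1 / (((k : ℝ) + 1) ^ 2 * (n + 1 + k).choose (k + 1)) =
      1 / ((n : ℝ) ^ 2 * (n + k).choose k) - 1 / ((n : ℝ) ^ 2 * (n + (k + 1)).choose (k + 1)) := by
  have hC : (0 : ℝ) < (n + k).choose k := by exact_mod_cast Nat.choose_pos (by lia)
  have hk : (0 : ℝ) < k + 1 := by positivity
  have : (0 : ℝ) < n := by positivity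
  have h₁ : ((n + k).choose (k + 1) : ℝ) = n * (n + k).choose k / (k + 1) := by
    rw [eq_div_iff hk.ne', cast_add_choose_succ_mul]
  have h₂ : ((n + 1 + k).choose (k + 1) : ℝ) = (n + k + 1) * (n + k).choose k / (k + 1) := by
    rw [eq_div_iff hk.ne', cast_add_choose_succ_mul, ← cast_add_add_one_choose_mul]
    push_cast
    ring
  rw [← add_assoc n k 1, add_right_comm n k 1, h₁, h₂]
  field_simp
  ring

theorem hasSum_one_div_sq_mul_choose (hn : 1 ≤ n) :
    HasSum (fun k : ℕ => 1 / (((k : ℝ) + 1) ^ 2 * (n + k).choose (k + 1)))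
      (Real.pi ^ 2 / 6 - ∑ j ∈ Finset.Ico 1 n, 1 / (j : ℝ) ^ 2) := by
  induction n, hn using Nat.le_induction with
  | base =>
    refine (hasSum_one_div_nat_add_sq le_rfl).congr_fun fun k => ?_
    simp [add_comm]
  | succ n hn ih =>
    set e : ℕ → ℝ := fun k => 1 / ((n : ℝ) ^ 2 * (n + k).choose k)
    have hanti : Antitone e := antitone_nat_of_succ_le fun k => by
      have : (n + k).choose k ≤ (n + (k + 1)).choose (k + 1) := by
        rw [← add_assoc, Nat.choose_succ_succ]
        exact Nat.le_add_right _ _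
      have hC : 0 < (n + k).choose k := Nat.choose_pos (by lia)
      dsimp only [e]
      gcongr
    have hlim : Tendsto e atTop (𝓝 0) := by
      refine squeeze_zero (fun k => by positivity) (fun k => ?_)
        tendsto_one_div_add_atTop_nhds_zero_nat
      have hC : k + 1 ≤ (n + k).choose k := by
        simpa [add_comm] using Nat.choose_le_choose k (show 1 + k ≤ n + k by lia)
      have hle : k + 1 ≤ n ^ 2 * (n + k).choose k :=
        hC.trans (Nat.le_mul_of_pos_left _ (by positivity))
      exact one_div_le_one_div_of_le (by positivity) (by exact_mod_cast hle)
    have hdiff := ih.sub (hasSum_sub_succ_of_antitone hanti hlim)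
    rw [Finset.sum_Ico_succ_top hn, ← sub_sub]
    simp only [e, ← one_div_sq_mul_choose_sub hn, sub_sub_cancel] at hdiff
    simpa using hdiff

end Series

section FisherInformation

theorem fisherInformation_eq_sq_mul_variance {S : Type*} [MeasurableSpace S] {μ P : Measure S}
    {p : ℝ → S → ℝ} {X : S → ℝ} {t c : ℝ} (hp : Measurable (p t)) (hp0 : ∀ x, 0 ≤ p t x)
    (hP : P = μ.withDensity fun x => ENNReal.ofReal (p t x)) (hX : AEMeasurable X P)
    (hscore : ∀ x, p t x ≠ 0 →
      HasDerivAt (fun s => Real.log (p s x)) (c * (X x - ∫ y, X y ∂P)) t) :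
    fisherInformation μ p t = c ^ 2 * variance X P := by
  rw [variance_eq_integral hX, ← integral_const_mul, fisherInformation]
  set m := ∫ y, X y ∂P
  rw [hP, integral_withDensity_eq_integral_toReal_smul hp.ennreal_ofReal
    (ae_of_all _ fun x => ENNReal.ofReal_lt_top)]
  refine integral_congr_ae (ae_of_all _ fun x => ?_)
  dsimp only
  rw [ENNReal.toReal_ofReal (hp0 x), smul_eq_mul]
  rcases eq_or_ne (p t x) 0 with hx | hx
  · simp [hx]
  · rw [(hscore x hx).deriv]
    ring

end FisherInformation

section Exponential

variable {l : ℝ}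

theorem isExpFamily_expMeasure :
    IsExpFamily (fun l : Set.Ioi (0 : ℝ) => expMeasure l) (fun x => x) where
  isProbabilityMeasure l := isProbabilityMeasure_expMeasure l.2
  measurable := measurable_id
  tilt l := by
    filter_upwards [Iio_mem_nhds l.2] with t ht
    exact ⟨⟨l - t, Set.mem_Ioi.2 (sub_pos.2 ht)⟩, (tilted_gammaMeasure one_pos l.2 ht).symm⟩

theorem isExpFamily_expSample (ν : ℕ) :
    IsExpFamily (fun l : Set.Ioi (0 : ℝ) => expSample ν l) (fun x => ∑ i, x i) :=
  isExpFamily_expMeasure.pi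

theorem map_sum_expSample {ν : ℕ} (hν : 1 ≤ ν) (hl : 0 < l) :
    (expSample ν l).map (fun x => ∑ i, x i) = gammaMeasure ν l := by
  have hν' : (0 : ℝ) < ν := by positivity
  have := isProbabilityMeasure_expMeasure hl
  have := isProbabilityMeasure_gammaMeasure hν' hl
  rw [← Measure.map_id (μ := gammaMeasure ν l)]
  refine map_sum_pi_eq_of_mgf (X := fun _ => id)
    (fun _ => zero_mem_interior_integrableExpSet_id_gammaMeasure one_pos hl)
    (zero_mem_interior_integrableExpSet_id_gammaMeasure hν' hl) ?_
  filter_upwards [Iio_mem_nhds hl] with t ht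
  rw [Finset.prod_const, Finset.card_univ, Fintype.card_fin, expMeasure,
    (integrable_exp_and_mgf_id_gammaMeasure one_pos hl ht).2,
    (integrable_exp_and_mgf_id_gammaMeasure hν' hl ht).2, Real.rpow_one, Real.rpow_natCast]

theorem map_eval_expSample {ν : ℕ} (i : Fin ν) (hl : 0 < l) :
    (expSample ν l).map (Function.eval i) = gammaMeasure 1 l := by
  have := isProbabilityMeasure_expMeasure hl
  exact (measurePreserving_eval (fun _ : Fin ν => expMeasure l) i).map_eq

theorem isUnbiased_harmonic_sub_log_gammaMeasure (n : ℕ) :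
    IsUnbiased (fun l : Set.Ioi (0 : ℝ) => gammaMeasure (n + 1) l) (fun l => Real.log l)
      (fun y => harmonic n - Real.eulerMascheroniConstant - Real.log y) := by
  have hprob (l : Set.Ioi (0 : ℝ)) : IsProbabilityMeasure (gammaMeasure (n + 1) l) :=
    isProbabilityMeasure_gammaMeasure (by positivity) l.2
  have hint (l : Set.Ioi (0 : ℝ)) : Integrable Real.log (gammaMeasure (n + 1) l) :=
    (memLp_log_gammaMeasure (by positivity) l.2).integrable one_le_two
  refine ⟨by fun_prop, fun l => (integrable_const _).sub (hint l), fun l => ?_⟩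
  rw [integral_sub (integrable_const _) (hint l),
    integral_log_gammaMeasure_nat_add_one n l.2]
  simp

theorem isUnbiased_neg_eulerMascheroniConstant_sub_log {ν : ℕ} (i : Fin ν) :
    IsUnbiased (fun l : Set.Ioi (0 : ℝ) => expSample ν l) (fun l => Real.log l)
      (fun x => -Real.eulerMascheroniConstant - Real.log (x i)) := by
  have h := isUnbiased_harmonic_sub_log_gammaMeasure 0
  simp only [Nat.cast_zero, zero_add, harmonic_zero, Rat.cast_zero, zero_sub] at h
  exact h.comp (measurable_pi_apply i) fun l => map_eval_expSample i l.2

theorem cast_harmonic_eq_sum_Ico (n : ℕ) :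
    (harmonic n : ℝ) = ∑ j ∈ Finset.Ico 1 (n + 1), 1 / (j : ℝ) := by
  simp [harmonic, Finset.sum_Ico_eq_sum_range, add_comm]

theorem L_eq_const_sub_log_comp_sum (ν : ℕ) :
    L ν = (fun y => ∑ j ∈ Finset.Ico 1 ν, 1 / (j : ℝ) - Real.eulerMascheroniConstant -
      Real.log y) ∘ fun x => ∑ i, x i := by
  ext x
  simp only [L, Function.comp_apply]
  ring

theorem measurable_comap_sum_L (ν : ℕ) :
    Measurable[MeasurableSpace.comap (fun x : Fin ν → ℝ => ∑ i, x i) inferInstance] (L ν) := by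
  rw [L_eq_const_sub_log_comp_sum]
  exact Measurable.comp (by fun_prop) (comap_measurable _)

theorem memLp_L {ν : ℕ} (hν : 1 ≤ ν) (hl : 0 < l) : MemLp (L ν) 2 (expSample ν l) := by
  have hν' : (0 : ℝ) < ν := by positivity
  have := isProbabilityMeasure_gammaMeasure hν' hl
  rw [L_eq_const_sub_log_comp_sum]
  refine MemLp.comp_of_map ?_ (by fun_prop)
  rw [map_sum_expSample hν hl]
  exact (memLp_const _).sub (memLp_log_gammaMeasure hν' hl)

theorem isUnbiased_L {ν : ℕ} (hν : 1 ≤ ν) :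
    IsUnbiased (fun l : Set.Ioi (0 : ℝ) => expSample ν l) (fun l => Real.log l) (L ν) := by
  obtain ⟨n, rfl⟩ := Nat.exists_eq_add_of_le' hν
  rw [L_eq_const_sub_log_comp_sum, ← cast_harmonic_eq_sum_Ico]
  refine (isUnbiased_harmonic_sub_log_gammaMeasure n).comp (by fun_prop) fun l => ?_
  rw [map_sum_expSample hν l.2, Nat.cast_add_one]

theorem isUMVUE_L {ν : ℕ} (hν : 1 ≤ ν) :
    IsUMVUE (fun l : Set.Ioi (0 : ℝ) => expSample ν l) (fun l => Real.log l) (L ν) :=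
  (isExpFamily_expSample ν).isUMVUE (measurable_comap_sum_L ν) (isUnbiased_L hν)
    fun l => memLp_L hν l.2

theorem ae_eq_L_of_isUMVUE {ν : ℕ} (hν : 1 ≤ ν) {L' : (Fin ν → ℝ) → ℝ}
    (hL' : IsUMVUE (fun l : Set.Ioi (0 : ℝ) => expSample ν l) (fun l => Real.log l) L')
    (hl : 0 < l) : L' =ᵐ[expSample ν l] L ν :=
  (isExpFamily_expSample ν).ae_eq_of_isUMVUE (measurable_comap_sum_L ν) (isUMVUE_L hν) hL' ⟨l, hl⟩

theorem condExp_sum_ae_eq_L {ν : ℕ} (i : Fin ν) (hl : 0 < l) :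
    (expSample ν l)[fun x : Fin ν → ℝ => -Real.eulerMascheroniConstant - Real.log (x i) |
        MeasurableSpace.comap (fun x : Fin ν → ℝ => ∑ i, x i) inferInstance]
      =ᵐ[expSample ν l] L ν :=
  (isExpFamily_expSample ν).condExp_ae_eq (measurable_comap_sum_L ν) (isUnbiased_L i.pos)
    (isUnbiased_neg_eulerMascheroniConstant_sub_log i) ⟨l, hl⟩

theorem hasSum_variance_L {ν : ℕ} (hν : 1 ≤ ν) (hl : 0 < l) :
    HasSum (fun k : ℕ => 1 / ((ν : ℝ) + k) ^ 2) (variance (L ν) (expSample ν l)) := by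
  have hν' : (0 : ℝ) < ν := by positivity
  have := isProbabilityMeasure_gammaMeasure hν' hl
  rw [L_eq_const_sub_log_comp_sum, ← variance_map (by fun_prop) (by fun_prop),
    map_sum_expSample hν hl, variance_const_sub (by fun_prop)]
  exact hasSum_variance_log_gammaMeasure hν' hl

theorem variance_L {ν : ℕ} (hν : 1 ≤ ν) (hl : 0 < l) :
    variance (L ν) (expSample ν l) =
      Real.pi ^ 2 / 6 - ∑ j ∈ Finset.Ico 1 ν, 1 / (j : ℝ) ^ 2 :=
  (hasSum_variance_L hν hl).unique (hasSum_one_div_nat_add_sq hν)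

theorem fisherInformation_exponentialPDFReal (hl : 0 < l) :
    fisherInformation volume exponentialPDFReal l = 1 / l ^ 2 := by
  have hscore (x : ℝ) (hx : exponentialPDFReal l x ≠ 0) :
      HasDerivAt (fun s => Real.log (exponentialPDFReal s x))
        (-1 * (x - ∫ y, y ∂(expMeasure l))) l := by
    have hx0 : 0 ≤ x := by
      by_contra hneg
      simp [exponentialPDFReal, gammaPDFReal, hneg] at hx
    have hlog : HasDerivAt (fun s => Real.log s - s * x) (-1 * (x - 1 / l)) l := by
      convert! (Real.hasDerivAt_log hl.ne').sub ((hasDerivAt_id l).mul_const x) using 1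
      ring
    rw [expMeasure, integral_id_gammaMeasure one_pos hl]
    refine hlog.congr_of_eventuallyEq ?_
    filter_upwards [Ioi_mem_nhds hl] with s hs
    simp [exponentialPDFReal, gammaPDFReal, hx0, Real.log_mul (ne_of_gt hs) (Real.exp_ne_zero _),
      sub_eq_add_neg]
  rw [fisherInformation_eq_sq_mul_variance (measurable_exponentialPDFReal l)
    (exponentialPDFReal_nonneg hl) (P := expMeasure l) rfl aemeasurable_id hscore, expMeasure,
    variance_id_gammaMeasure one_pos hl]
  norm_num

theorem cramerRaoBound_log_exponentialPDFReal (ν : ℕ) (hl : 0 < l) :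
    cramerRaoBound volume exponentialPDFReal Real.log ν l = 1 / ν := by
  rw [cramerRaoBound, fisherInformation_exponentialPDFReal hl, Real.deriv_log]
  field_simp

theorem tendsto_variance_L_div_cramerRaoBound (hl : 0 < l) :
    Tendsto (fun ν : ℕ => variance (L ν) (expSample ν l) /
      cramerRaoBound volume exponentialPDFReal Real.log ν l) atTop (𝓝 1) := by
  have hup : Tendsto (fun ν : ℕ => 1 + 1 / (ν : ℝ)) atTop (𝓝 1) := by
    simpa using tendsto_one_div_atTop_nhds_zero_nat.const_add (1 : ℝ)
  refine tendsto_of_tendsto_of_tendsto_of_le_of_le' tendsto_const_nhds hup ?_ ?_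
  all_goals
    filter_upwards [eventually_ge_atTop 1] with ν hν
    rw [cramerRaoBound_log_exponentialPDFReal ν hl, div_div_eq_mul_div, div_one, mul_comm]
  · exact (one_lt_mul_of_hasSum_one_div_add_sq (by positivity) (hasSum_variance_L hν hl)).le
  · exact (mul_lt_of_hasSum_one_div_add_sq (by positivity) (hasSum_variance_L hν hl)).le

end Exponential

section PowerSeries

open PowerSeries

theorem coeff_X_mul_derivative {R : Type*} [CommRing R] (F : R⟦X⟧) (n : ℕ) :
    coeff n (X * d⁄dX R F) = n * coeff n F := by
  cases n with
  | zero => simp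
  | succ n =>
    rw [coeff_succ_X_mul, coeff_derivative, Nat.cast_succ, mul_comm]

theorem coeff_one_sub_X_mul_derivative {R : Type*} [CommRing R] (F : R⟦X⟧) (n : ℕ) :
    coeff n ((1 - X) * d⁄dX R F) = (n + 1) * coeff (n + 1) F - n * coeff n F := by
  rw [sub_mul, one_mul, map_sub, coeff_X_mul_derivative, coeff_derivative, mul_comm]

theorem eq_zero_of_one_sub_X_mul_derivative_eq {F : ℝ⟦X⟧} {c : ℝ} (h0 : constantCoeff F = 0)
    (hF : (1 - X) * d⁄dX ℝ F = C c * F) : F = 0 := by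
  ext n
  induction n with
  | zero => simpa using h0
  | succ n ih =>
    have hn := congrArg (coeff n) hF
    rw [coeff_one_sub_X_mul_derivative, coeff_C_mul, ih] at hn
    simpa [Nat.cast_add_one_ne_zero n] using hn

theorem eq_of_X_mul_derivative_add_eq {F G : ℝ⟦X⟧} {c : ℝ} (hc : 0 < c)
    (h : X * d⁄dX ℝ F + C c * F = X * d⁄dX ℝ G + C c * G) : F = G := by
  ext n
  have hn := congrArg (coeff n) h
  simp only [map_add, coeff_X_mul_derivative, coeff_C_mul, ← add_mul] at hn
  exact mul_left_cancel₀ (by positivity) hn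

theorem hasSum_coeff_mul {F G : ℝ⟦X⟧} {q x y : ℝ}
    (hF : HasSum (fun n => coeff n F * q ^ n) x) (hG : HasSum (fun n => coeff n G * q ^ n) y) :
    HasSum (fun n => coeff n (F * G) * q ^ n) (x * y) := by
  have hcauchy (n : ℕ) : coeff n (F * G) * q ^ n = ∑ kl ∈ Finset.HasAntidiagonal.antidiagonal n,
      (coeff kl.1 F * q ^ kl.1) * (coeff kl.2 G * q ^ kl.2) := by
    rw [coeff_mul, Finset.sum_mul]
    refine Finset.sum_congr rfl fun kl hkl => ?_
    rw [← Finset.HasAntidiagonal.mem_antidiagonal.1 hkl, pow_add]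
    ring
  have hF' := hF.summable.norm
  have hG' := hG.summable.norm
  simp only [hcauchy]
  rw [← hF.tsum_eq, ← hG.tsum_eq, tsum_mul_tsum_eq_tsum_sum_antidiagonal_of_summable_norm hF' hG']
  exact (summable_norm_sum_mul_antidiagonal_of_summable_norm hF' hG').of_norm.hasSum

/-- The power series of `-log (1 - x)`; its constant term is `1 / 0 = 0`. -/
noncomputable def negLogOneSub : ℝ⟦X⟧ :=
  mk fun n => 1 / (n : ℝ)

theorem one_sub_X_mul_derivative_negLogOneSub : (1 - X) * d⁄dX ℝ negLogOneSub = 1 := by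
  ext n
  rw [coeff_one_sub_X_mul_derivative, negLogOneSub, coeff_mk, coeff_mk, coeff_one, Nat.cast_succ,
    mul_one_div_cancel n.cast_add_one_ne_zero]
  rcases eq_or_ne n 0 with rfl | hn
  · simp
  · simp [hn]

theorem hasSum_negLogOneSub {q : ℝ} (hq : |q| < 1) :
    HasSum (fun n => coeff n negLogOneSub * q ^ n) (-Real.log (1 - q)) := by
  rw [← hasSum_nat_add_iff' 1]
  simpa [negLogOneSub, div_eq_inv_mul] using Real.hasSum_pow_div_log_of_abs_lt_one hq

/-- The generating function `∑ n, (n + m).choose m * f n * x ^ n`. Up to the factor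
`(1 - x) ^ (m + 1)` it is the expectation of `f` under the negative binomial law of size `m + 1`
and success probability `1 - x`. -/
noncomputable def negBinSeries (m : ℕ) (f : ℕ → ℝ) : ℝ⟦X⟧ :=
  mk fun n => (n + m).choose m * f n

variable (m : ℕ)

theorem negBinSeries_add (f g : ℕ → ℝ) :
    negBinSeries m (f + g) = negBinSeries m f + negBinSeries m g := by
  ext n
  simp [negBinSeries, mul_add]

theorem negBinSeries_const_mul (c : ℝ) (f : ℕ → ℝ) :
    negBinSeries m (fun n => c * f n) = C c * negBinSeries m f := by
  ext n
  simp [negBinSeries, mul_left_comm]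

theorem one_sub_X_mul_derivative_negBinSeries (f : ℕ → ℝ) :
    (1 - X) * d⁄dX ℝ (negBinSeries m f) = C ((m : ℝ) + 1) * negBinSeries m f +
      negBinSeries m fun n => (m + 1 + n) * (f (n + 1) - f n) := by
  ext n
  rw [coeff_one_sub_X_mul_derivative, map_add, coeff_C_mul]
  simp only [negBinSeries, coeff_mk]
  have hchoose := cast_add_add_one_choose_mul n m
  linear_combination f (n + 1) * hchoose

theorem one_sub_X_mul_derivative_negBinSeries_one :
    (1 - X) * d⁄dX ℝ (negBinSeries m 1) = C ((m : ℝ) + 1) * negBinSeries m 1 := by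
  rw [one_sub_X_mul_derivative_negBinSeries]
  simp [negBinSeries, PowerSeries.ext_iff]

theorem negBinSeries_eq_mul_of_derivative {f : ℕ → ℝ} {F : ℝ⟦X⟧} (h0 : constantCoeff F = f 0)
    (h : (1 - X) * d⁄dX ℝ F * negBinSeries m 1 =
      negBinSeries m fun n => (m + 1 + n) * (f (n + 1) - f n)) :
    negBinSeries m f = F * negBinSeries m 1 := by
  refine sub_eq_zero.1 (eq_zero_of_one_sub_X_mul_derivative_eq (c := (m : ℝ) + 1) ?_ ?_)
  · simp [negBinSeries, h0]
  · rw [map_sub, mul_sub, one_sub_X_mul_derivative_negBinSeries, ← h, Derivation.leibniz,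
      smul_eq_mul, smul_eq_mul]
    linear_combination -F * one_sub_X_mul_derivative_negBinSeries_one m

theorem hasSum_negBinSeries_one {q : ℝ} (hq : |q| < 1) :
    HasSum (fun n => coeff n (negBinSeries m 1) * q ^ n) (1 / (1 - q) ^ (m + 1)) := by
  simpa [negBinSeries] using hasSum_choose_mul_geometric_of_norm_lt_one m (r := q) hq

/-- The generating function of the variances of the statistics `T (m + 1)`, in powers of the
failure probability `1 - θ`; its constant term is `1 / 0 = 0`. -/
noncomputable def varianceSeries : ℝ⟦X⟧ :=
  mk fun n => 1 / ((n : ℝ) ^ 2 * (m + n).choose n)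

theorem coeff_derivative_varianceSeries (n : ℕ) :
    coeff n (d⁄dX ℝ (varianceSeries m)) = 1 / ((m + 1) * (m + 1 + n).choose n) := by
  have hchoose := cast_add_choose_succ_mul (m + 1) n
  rw [coeff_derivative, varianceSeries, coeff_mk, show m + (n + 1) = m + 1 + n by ring]
  push_cast at hchoose ⊢
  rw [← hchoose]
  have hpos : (0 : ℝ) < (m + 1 + n).choose (n + 1) := by
    exact_mod_cast Nat.choose_pos (by lia)
  field_simp

theorem X_mul_one_sub_X_mul_derivative_derivative_varianceSeries :
    X * ((1 - X) * d⁄dX ℝ (d⁄dX ℝ (varianceSeries m))) +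
      (C ((m : ℝ) + 1) - X) * d⁄dX ℝ (varianceSeries m) = 1 := by
  ext n
  rw [sub_mul (C ((m : ℝ) + 1)), map_add, map_sub, coeff_C_mul, coeff_one]
  cases n with
  | zero =>
    have : (m : ℝ) + 1 ≠ 0 := by positivity
    simp [coeff_derivative_varianceSeries, this]
  | succ n =>
    have hchoose := Nat.add_one_mul_choose_eq (m + 1 + n) n
    have hpos : (0 : ℝ) < (m + 1 + n).choose n := by exact_mod_cast Nat.choose_pos (by lia)
    have hchoose' : ((m + 1 + (n + 1)).choose (n + 1) : ℝ) =
        (m + n + 2) * (m + 1 + n).choose n / (n + 1) := by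
      rw [eq_div_iff (by positivity), ← add_assoc]
      have : ((m + 1 + n + 1 : ℕ) : ℝ) = m + n + 2 := by push_cast; ring
      rw [← this]
      exact_mod_cast hchoose.symm
    rw [coeff_succ_X_mul, coeff_succ_X_mul, coeff_one_sub_X_mul_derivative,
      coeff_derivative_varianceSeries, coeff_derivative_varianceSeries, if_neg n.succ_ne_zero,
      hchoose']
    field_simp
    ring

theorem summable_varianceSeries {q : ℝ} (hq : |q| < 1) :
    Summable (fun n => coeff n (varianceSeries m) * q ^ n) := by
  refine .of_norm_bounded (summable_geometric_of_abs_lt_one (r := |q|) (by simpa)) fun n => ?_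
  have hle : 1 / ((n : ℝ) ^ 2 * (m + n).choose n) ≤ 1 := by
    have : (n : ℝ) ^ 2 * (m + n).choose n = ((n ^ 2 * (m + n).choose n : ℕ) : ℝ) := by
      push_cast; rfl
    rw [this, one_div]
    exact Nat.cast_inv_le_one _
  rw [varianceSeries, coeff_mk, norm_mul, norm_pow, Real.norm_eq_abs, Real.norm_eq_abs,
    abs_of_nonneg (by positivity)]
  exact mul_le_of_le_one_left (by positivity) hle

theorem negBinSeries_one_div :
    negBinSeries m (fun n => 1 / ((m : ℝ) + 1 + n)) =
      (1 - X) * d⁄dX ℝ (varianceSeries m) * negBinSeries m 1 := by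
  refine eq_of_X_mul_derivative_add_eq (c := (m : ℝ) + 1) (by positivity) ?_
  trans negBinSeries m 1
  · ext n
    rw [map_add, coeff_X_mul_derivative, coeff_C_mul]
    simp only [negBinSeries, coeff_mk, Pi.one_apply]
    field_simp
    ring
  · simp only [Derivation.leibniz, smul_eq_mul, map_sub, Derivation.map_one_eq_zero, derivative_X]
    linear_combination
      -(X * d⁄dX ℝ (varianceSeries m)) * one_sub_X_mul_derivative_negBinSeries_one m -
        negBinSeries m 1 * X_mul_one_sub_X_mul_derivative_derivative_varianceSeries m

/-- The statistic `T ν` as a function of the value `n` of the sample sum, with a real parameter `a`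
in place of `ν`. -/
noncomputable def shiftedHarmonic (a : ℝ) (n : ℕ) : ℝ :=
  ∑ j ∈ Finset.range n, 1 / (a + j)

theorem shiftedHarmonic_succ (a : ℝ) (n : ℕ) :
    shiftedHarmonic a (n + 1) = shiftedHarmonic a n + 1 / (a + n) :=
  Finset.sum_range_succ _ _

theorem negBinSeries_shiftedHarmonic :
    negBinSeries m (shiftedHarmonic (m + 1)) = negLogOneSub * negBinSeries m 1 := by
  refine negBinSeries_eq_mul_of_derivative m (by simp [negLogOneSub, shiftedHarmonic]) ?_
  rw [one_sub_X_mul_derivative_negLogOneSub, one_mul]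
  congr 1
  ext n
  rw [shiftedHarmonic_succ, add_sub_cancel_left, mul_one_div_cancel (by positivity), Pi.one_apply]

theorem negBinSeries_shiftedHarmonic_sq :
    negBinSeries m (fun n => shiftedHarmonic (m + 1) n ^ 2) =
      (negLogOneSub * negLogOneSub + varianceSeries m) * negBinSeries m 1 := by
  have hincrement : (fun n : ℕ => ((m : ℝ) + 1 + n) *
      (shiftedHarmonic (m + 1) (n + 1) ^ 2 - shiftedHarmonic (m + 1) n ^ 2)) =
      (fun n => 2 * shiftedHarmonic (m + 1) n) + fun n : ℕ => 1 / ((m : ℝ) + 1 + n) := by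
    ext n
    have : (m : ℝ) + 1 + n ≠ 0 := by positivity
    rw [Pi.add_apply, shiftedHarmonic_succ]
    field_simp
    ring
  refine negBinSeries_eq_mul_of_derivative m
    (by simp [negLogOneSub, varianceSeries, shiftedHarmonic]) ?_
  rw [hincrement, negBinSeries_add, negBinSeries_const_mul, negBinSeries_shiftedHarmonic,
    negBinSeries_one_div, Derivation.map_add, Derivation.leibniz, smul_eq_mul, map_ofNat]
  linear_combination
    2 * negLogOneSub * negBinSeries m 1 * one_sub_X_mul_derivative_negLogOneSub

end PowerSeries

section NegativeBinomial

variable {θ : Set.Ioo (0 : ℝ) 1} {t : ℝ}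

/-- The negative binomial law: the number of failures before success number `m + 1` in independent
trials with success probability `θ`. The size is `m + 1`, so that no subtraction occurs. -/
noncomputable def negBin (m : ℕ) (θ : Set.Ioo (0 : ℝ) 1) : Measure ℕ :=
  Measure.sum fun n =>
    ENNReal.ofReal ((θ : ℝ) ^ (m + 1) * ((n + m).choose m * (1 - θ) ^ n)) • Measure.dirac n

theorem abs_one_sub_lt_one (θ : Set.Ioo (0 : ℝ) 1) : |1 - (θ : ℝ)| < 1 :=
  abs_lt.2 ⟨by linarith [θ.2.2], by linarith [θ.2.1]⟩

theorem negBin_weight_nonneg (m : ℕ) (θ : Set.Ioo (0 : ℝ) 1) (n : ℕ) :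
    0 ≤ (θ : ℝ) ^ (m + 1) * ((n + m).choose m * (1 - θ) ^ n) := by
  have hθ := θ.2.1
  have hq := sub_pos.2 θ.2.2
  positivity

theorem negBin_singleton (m : ℕ) (θ : Set.Ioo (0 : ℝ) 1) (n : ℕ) :
    negBin m θ {n} = ENNReal.ofReal ((θ : ℝ) ^ (m + 1) * ((n + m).choose m * (1 - θ) ^ n)) :=
  Measure.sum_smul_dirac_singleton

instance (m : ℕ) (θ : Set.Ioo (0 : ℝ) 1) : IsProbabilityMeasure (negBin m θ) := by
  have hθ : (0 : ℝ) < θ := θ.2.1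
  refine HasSum.isProbabilityMeasure_sum_dirac (negBin_weight_nonneg m θ) ?_
  have hsum := (hasSum_negBinSeries_one m (abs_one_sub_lt_one θ)).mul_left ((θ : ℝ) ^ (m + 1))
  rw [sub_sub_cancel, mul_one_div_cancel (by positivity)] at hsum
  simpa [negBinSeries] using hsum

theorem integrable_and_integral_negBin_of_negBinSeries_eq {m : ℕ} {f : ℕ → ℝ} {F : PowerSeries ℝ}
    {s : ℝ} (hF : negBinSeries m f = F * negBinSeries m 1)
    (hs : HasSum (fun n => PowerSeries.coeff n F * (1 - (θ : ℝ)) ^ n) s) :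
    Integrable f (negBin m θ) ∧ ∫ n, f n ∂(negBin m θ) = s := by
  have hθ : (0 : ℝ) < θ := θ.2.1
  have hterm (n : ℕ) :
      (ENNReal.ofReal ((θ : ℝ) ^ (m + 1) * ((n + m).choose m * (1 - θ) ^ n))).toReal * f n =
        θ ^ (m + 1) * (PowerSeries.coeff n (F * negBinSeries m 1) * (1 - θ) ^ n) := by
    rw [ENNReal.toReal_ofReal (negBin_weight_nonneg m θ n), ← hF, negBinSeries,
      PowerSeries.coeff_mk]
    ring
  have hsum := (hasSum_coeff_mul hs (hasSum_negBinSeries_one m (abs_one_sub_lt_one θ))).mul_left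
    ((θ : ℝ) ^ (m + 1))
  rw [sub_sub_cancel, mul_left_comm, mul_one_div_cancel (by positivity), mul_one] at hsum
  simp only [← hterm] at hsum
  rw [negBin]
  constructor
  · rw [integrable_sum_dirac_iff (by simp)]
    simpa [abs_mul] using hsum.summable.norm
  · rw [integral_sum_dirac (by simp)]
    exact hsum.tsum_eq

theorem negBin_eq_withDensity (m : ℕ) {θ' : Set.Ioo (0 : ℝ) 1}
    (h : 1 - (θ' : ℝ) = (1 - θ) * Real.exp t) :
    negBin m θ' = (negBin m θ).withDensity
      fun n => ENNReal.ofReal (Real.exp (t * n) / ((θ : ℝ) / θ') ^ (m + 1)) := by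
  have hθ : (0 : ℝ) < θ := θ.2.1
  have hθ' : (0 : ℝ) < θ' := θ'.2.1
  refine Measure.ext_of_singleton fun n => ?_
  rw [withDensity_apply _ (measurableSet_singleton n), lintegral_singleton, negBin_singleton,
    negBin_singleton, ← ENNReal.ofReal_mul (by positivity), h, mul_pow, mul_comm t,
    Real.exp_nat_mul, div_pow]
  congr 1
  field_simp

theorem eventually_exists_one_sub_eq_mul_exp (θ : Set.Ioo (0 : ℝ) 1) :
    ∀ᶠ t in 𝓝 (0 : ℝ), ∃ θ' : Set.Ioo (0 : ℝ) 1, 1 - (θ' : ℝ) = (1 - θ) * Real.exp t := by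
  have hcont : ContinuousAt (fun t => 1 - (1 - (θ : ℝ)) * Real.exp t) 0 := by fun_prop
  filter_upwards [hcont.eventually_mem (Ioo_mem_nhds (by simpa using θ.2.1) (by simpa using θ.2.2))]
    with t ht
  exact ⟨⟨_, ht⟩, sub_sub_cancel _ _⟩

theorem integrable_exp_and_mgf_negBin (m : ℕ) {θ' : Set.Ioo (0 : ℝ) 1}
    (h : 1 - (θ' : ℝ) = (1 - θ) * Real.exp t) :
    Integrable (fun n : ℕ => Real.exp (t * n)) (negBin m θ) ∧
      mgf (↑) (negBin m θ) t = ((θ : ℝ) / θ') ^ (m + 1) :=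
  integral_exp_of_eq_withDensity (pow_pos (div_pos θ.2.1 θ'.2.1) _) (by fun_prop)
    (negBin_eq_withDensity m h)

theorem isExpFamily_negBin (m : ℕ) : IsExpFamily (negBin m) (↑) where
  isProbabilityMeasure _ := inferInstance
  measurable := by fun_prop
  tilt θ := by
    filter_upwards [eventually_exists_one_sub_eq_mul_exp θ] with t ⟨θ', hθ'⟩
    exact ⟨θ', eq_tilted_of_eq_withDensity (pow_pos (div_pos θ.2.1 θ'.2.1) _) (by fun_prop)
      (negBin_eq_withDensity m hθ')⟩

theorem zero_mem_interior_integrableExpSet_negBin (m : ℕ) (θ : Set.Ioo (0 : ℝ) 1) :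
    0 ∈ interior (integrableExpSet (↑) (negBin m θ)) := by
  rw [mem_interior_iff_mem_nhds]
  filter_upwards [eventually_exists_one_sub_eq_mul_exp θ] with t ⟨θ', hθ'⟩
  exact (integrable_exp_and_mgf_negBin m hθ').1

theorem map_sum_pi_negBin_zero (m : ℕ) (θ : Set.Ioo (0 : ℝ) 1) :
    (Measure.pi fun _ : Fin (m + 1) => negBin 0 θ).map (fun x => ∑ i, x i) = negBin m θ := by
  have hcast : MeasurableEmbedding ((↑) : ℕ → ℝ) :=
    Nat.isClosedEmbedding_coe_real.measurableEmbedding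
  refine hcast.map_injective ?_
  rw [Measure.map_map hcast.measurable (by fun_prop)]
  simp only [Function.comp_def, Nat.cast_sum]
  refine map_sum_pi_eq_of_mgf (ρ := negBin m θ) (X := fun _ (n : ℕ) => (n : ℝ))
    (Y := fun n : ℕ => (n : ℝ)) (fun _ => zero_mem_interior_integrableExpSet_negBin 0 θ)
    (zero_mem_interior_integrableExpSet_negBin m θ) ?_
  filter_upwards [eventually_exists_one_sub_eq_mul_exp θ] with t ⟨θ', hθ'⟩
  simp [(integrable_exp_and_mgf_negBin _ hθ').2, div_pow]

theorem cgf_negBin_eventuallyEq (m : ℕ) (θ : Set.Ioo (0 : ℝ) 1) :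
    cgf (↑) (negBin m θ) =ᶠ[𝓝 0]
      fun t => (m + 1) * (Real.log θ - Real.log (1 - (1 - θ) * Real.exp t)) := by
  filter_upwards [eventually_exists_one_sub_eq_mul_exp θ] with t ⟨θ', hθ'⟩
  rw [cgf, (integrable_exp_and_mgf_negBin m hθ').2, ← hθ', sub_sub_cancel, Real.log_pow,
    Real.log_div θ.2.1.ne' θ'.2.1.ne', Nat.cast_succ]

theorem hasDerivAt_cgf_negBin (m : ℕ) (θ : Set.Ioo (0 : ℝ) 1)
    (ht : 1 - (1 - (θ : ℝ)) * Real.exp t ≠ 0) :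
    HasDerivAt (fun t => (m + 1) * (Real.log θ - Real.log (1 - (1 - θ) * Real.exp t)))
      ((m + 1) * ((1 - (1 - (θ : ℝ)) * Real.exp t)⁻¹ - 1)) t := by
  convert! (((((Real.hasDerivAt_exp t).const_mul (1 - (θ : ℝ))).const_sub 1).log ht).const_sub
    (Real.log θ)).const_mul ((m : ℝ) + 1) using 1
  field_simp
  ring

theorem integral_cast_negBin (m : ℕ) (θ : Set.Ioo (0 : ℝ) 1) :
    ∫ n : ℕ, (n : ℝ) ∂(negBin m θ) = (m + 1) * ((θ : ℝ)⁻¹ - 1) := by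
  refine integral_eq_of_cgf_eventuallyEq (zero_mem_interior_integrableExpSet_negBin m θ)
    (cgf_negBin_eventuallyEq m θ) ?_
  simpa using hasDerivAt_cgf_negBin m θ (t := 0) (by simpa using θ.2.1.ne')

theorem variance_cast_negBin (m : ℕ) (θ : Set.Ioo (0 : ℝ) 1) :
    variance (↑) (negBin m θ) = (m + 1) * ((1 - (θ : ℝ)) / θ ^ 2) := by
  refine variance_eq_of_cgf_eventuallyEq (zero_mem_interior_integrableExpSet_negBin m θ)
    (cgf_negBin_eventuallyEq m θ)
    (K' := fun t => (m + 1) * ((1 - (1 - (θ : ℝ)) * Real.exp t)⁻¹ - 1)) ?_ ?_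
  · filter_upwards [eventually_exists_one_sub_eq_mul_exp θ] with t ⟨θ', hθ'⟩
    refine hasDerivAt_cgf_negBin m θ ?_
    rw [← hθ', sub_sub_cancel]
    exact θ'.2.1.ne'
  · have hinv := (((Real.hasDerivAt_exp 0).const_mul (1 - (θ : ℝ))).const_sub 1).inv
      (by simpa using θ.2.1.ne')
    simpa using (hinv.sub_const 1).const_mul ((m : ℝ) + 1)

end NegativeBinomial

section Geometric

theorem geometricMeasure_eq_negBin_zero (θ : Set.Ioo (0 : ℝ) 1) :
    geometricMeasure ⟨θ, θ.2.1.le, θ.2.2.le⟩ = negBin 0 θ := by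
  have hne : (⟨θ, θ.2.1.le, θ.2.2.le⟩ : unitInterval) ≠ 0 := Subtype.coe_ne_coe.1 θ.2.1.ne'
  refine Measure.ext_of_singleton fun n => ?_
  rw [geometricMeasure_singleton hne, negBin_singleton]
  simp [mul_comm]

theorem geomSample_eq_pi_negBin_zero (ν : ℕ) (θ : Set.Ioo (0 : ℝ) 1) :
    geomSample ν θ = Measure.pi fun _ => negBin 0 θ := by
  rw [geomSample, geometricMeasure_eq_negBin_zero]

theorem isExpFamily_geomSample (ν : ℕ) :
    IsExpFamily (geomSample ν) (fun x => ∑ i, (x i : ℝ)) := by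
  simpa only [← geomSample_eq_pi_negBin_zero] using (isExpFamily_negBin 0).pi (ι := Fin ν)

theorem map_sum_geomSample (m : ℕ) (θ : Set.Ioo (0 : ℝ) 1) :
    (geomSample (m + 1) θ).map (fun x => ∑ i, x i) = negBin m θ := by
  rw [geomSample_eq_pi_negBin_zero, map_sum_pi_negBin_zero]

theorem T_eq_shiftedHarmonic_comp_sum (ν : ℕ) :
    T ν = shiftedHarmonic ν ∘ fun x => ∑ i, x i :=
  rfl

theorem measurable_comap_sum_T (ν : ℕ) :
    Measurable[MeasurableSpace.comap (fun x : Fin ν → ℕ => ∑ i, (x i : ℝ)) inferInstance]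
      (T ν) := by
  have hmeas : Measurable fun y : ℝ => shiftedHarmonic ν ⌊y⌋₊ :=
    (measurable_from_nat (f := shiftedHarmonic ν)).comp Nat.measurable_floor
  have hfloor : T ν = (fun y : ℝ => shiftedHarmonic ν ⌊y⌋₊) ∘ fun x => ∑ i, (x i : ℝ) := by
    ext x
    simp only [T_eq_shiftedHarmonic_comp_sum, Function.comp_apply, ← Nat.cast_sum,
      Nat.floor_natCast]
  rw [hfloor]
  exact hmeas.comp (comap_measurable _)

theorem integrable_and_integral_shiftedHarmonic_negBin (m : ℕ) (θ : Set.Ioo (0 : ℝ) 1) :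
    Integrable (shiftedHarmonic (m + 1)) (negBin m θ) ∧
      ∫ n, shiftedHarmonic (m + 1) n ∂(negBin m θ) = -Real.log θ := by
  have hlog := hasSum_negLogOneSub (abs_one_sub_lt_one θ)
  rw [sub_sub_cancel] at hlog
  exact integrable_and_integral_negBin_of_negBinSeries_eq (negBinSeries_shiftedHarmonic m) hlog

theorem integrable_and_integral_shiftedHarmonic_sq_negBin (m : ℕ) (θ : Set.Ioo (0 : ℝ) 1) :
    Integrable (fun n => shiftedHarmonic (m + 1) n ^ 2) (negBin m θ) ∧
      ∫ n, shiftedHarmonic (m + 1) n ^ 2 ∂(negBin m θ) =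
        -Real.log θ * -Real.log θ +
          ∑' n, PowerSeries.coeff n (varianceSeries m) * (1 - (θ : ℝ)) ^ n := by
  have hlog := hasSum_negLogOneSub (abs_one_sub_lt_one θ)
  rw [sub_sub_cancel] at hlog
  refine integrable_and_integral_negBin_of_negBinSeries_eq (negBinSeries_shiftedHarmonic_sq m) ?_
  simp only [map_add, add_mul]
  exact (hasSum_coeff_mul hlog hlog).add (summable_varianceSeries m (abs_one_sub_lt_one θ)).hasSum

theorem memLp_shiftedHarmonic_negBin (m : ℕ) (θ : Set.Ioo (0 : ℝ) 1) :
    MemLp (shiftedHarmonic (m + 1)) 2 (negBin m θ) :=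
  (memLp_two_iff_integrable_sq (by fun_prop)).2
    (integrable_and_integral_shiftedHarmonic_sq_negBin m θ).1

theorem variance_shiftedHarmonic_negBin (m : ℕ) (θ : Set.Ioo (0 : ℝ) 1) :
    variance (shiftedHarmonic (m + 1)) (negBin m θ) =
      ∑' n, PowerSeries.coeff n (varianceSeries m) * (1 - (θ : ℝ)) ^ n := by
  rw [variance_eq_sub (memLp_shiftedHarmonic_negBin m θ),
    (integrable_and_integral_shiftedHarmonic_negBin m θ).2]
  simp only [Pi.pow_apply]
  rw [(integrable_and_integral_shiftedHarmonic_sq_negBin m θ).2]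
  ring

theorem isUnbiased_T {ν : ℕ} (hν : 1 ≤ ν) :
    IsUnbiased (geomSample ν) (fun θ => -Real.log θ) (T ν) := by
  obtain ⟨m, rfl⟩ := Nat.exists_eq_add_of_le' hν
  rw [T_eq_shiftedHarmonic_comp_sum, Nat.cast_add_one]
  refine IsUnbiased.comp ⟨by fun_prop, fun θ => ?_, fun θ => ?_⟩ (by fun_prop)
    (map_sum_geomSample m)
  · exact (integrable_and_integral_shiftedHarmonic_negBin m θ).1
  · exact (integrable_and_integral_shiftedHarmonic_negBin m θ).2

theorem memLp_T {ν : ℕ} (hν : 1 ≤ ν) (θ : Set.Ioo (0 : ℝ) 1) :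
    MemLp (T ν) 2 (geomSample ν θ) := by
  obtain ⟨m, rfl⟩ := Nat.exists_eq_add_of_le' hν
  rw [T_eq_shiftedHarmonic_comp_sum, Nat.cast_add_one]
  refine MemLp.comp_of_map ?_ (by fun_prop)
  rw [map_sum_geomSample]
  exact memLp_shiftedHarmonic_negBin m θ

theorem isUMVUE_T {ν : ℕ} (hν : 1 ≤ ν) :
    IsUMVUE (geomSample ν) (fun θ => -Real.log θ) (T ν) :=
  (isExpFamily_geomSample ν).isUMVUE (measurable_comap_sum_T ν) (isUnbiased_T hν) (memLp_T hν)

theorem ae_eq_T_of_isUMVUE {ν : ℕ} (hν : 1 ≤ ν) {T' : (Fin ν → ℕ) → ℝ}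
    (hT' : IsUMVUE (geomSample ν) (fun θ => -Real.log θ) T') (θ : Set.Ioo (0 : ℝ) 1) :
    T' =ᵐ[geomSample ν θ] T ν :=
  (isExpFamily_geomSample ν).ae_eq_of_isUMVUE (measurable_comap_sum_T ν) (isUMVUE_T hν) hT' θ

theorem hasSum_variance_T {ν : ℕ} (hν : 1 ≤ ν) (θ : Set.Ioo (0 : ℝ) 1) :
    HasSum (fun k : ℕ => (1 - (θ : ℝ)) ^ (k + 1) /
        (((k : ℝ) + 1) ^ 2 * ((ν + k).choose (k + 1) : ℝ)))
      (variance (T ν) (geomSample ν θ)) := by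
  obtain ⟨m, rfl⟩ := Nat.exists_eq_add_of_le' hν
  rw [T_eq_shiftedHarmonic_comp_sum, Nat.cast_add_one,
    ← variance_map (by fun_prop) (by fun_prop), map_sum_geomSample,
    variance_shiftedHarmonic_negBin]
  have hsum := (summable_varianceSeries m (abs_one_sub_lt_one θ)).hasSum
  rw [← hasSum_nat_add_iff' 1] at hsum
  simpa [varianceSeries, div_eq_inv_mul, add_assoc, add_comm, add_left_comm] using hsum

theorem negBin_zero_eq_withDensity_count (θ : Set.Ioo (0 : ℝ) 1) :
    negBin 0 θ = Measure.count.withDensity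
      fun x : ℕ => ENNReal.ofReal ((θ : ℝ) * (1 - (θ : ℝ)) ^ x) := by
  refine Measure.ext_of_singleton fun n => ?_
  rw [withDensity_apply _ (measurableSet_singleton n), lintegral_singleton, negBin_singleton]
  simp

theorem fisherInformation_geometric (θ : Set.Ioo (0 : ℝ) 1) :
    fisherInformation Measure.count (fun (t : ℝ) (x : ℕ) => t * (1 - t) ^ x) θ =
      1 / ((θ : ℝ) ^ 2 * (1 - θ)) := by
  have hθ : (0 : ℝ) < θ := θ.2.1
  have hq : 0 < 1 - (θ : ℝ) := sub_pos.2 θ.2.2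
  have hscore (x : ℕ) : HasDerivAt (fun s => Real.log (s * (1 - s) ^ x))
      (-(1 - (θ : ℝ))⁻¹ * (x - ∫ n : ℕ, (n : ℝ) ∂(negBin 0 θ))) θ := by
    have hlog : HasDerivAt (fun s => Real.log s + x * Real.log (1 - s))
        (-(1 - (θ : ℝ))⁻¹ * (x - ((θ : ℝ)⁻¹ - 1))) θ := by
      convert! (Real.hasDerivAt_log hθ.ne').fun_add
        ((((hasDerivAt_id (θ : ℝ)).const_sub 1).log hq.ne').const_mul (x : ℝ)) using 1
      simp only [id]
      field_simp
      ring
    rw [integral_cast_negBin, Nat.cast_zero, zero_add, one_mul]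
    refine hlog.congr_of_eventuallyEq ?_
    filter_upwards [Ioo_mem_nhds hθ θ.2.2] with s hs
    rw [Real.log_mul hs.1.ne' (pow_ne_zero x (sub_pos.2 hs.2).ne'), Real.log_pow]
  have hp (x : ℕ) : 0 ≤ (θ : ℝ) * (1 - θ) ^ x := by positivity
  rw [fisherInformation_eq_sq_mul_variance (μ := .count)
    (p := fun (t : ℝ) (x : ℕ) => t * (1 - t) ^ x) (P := negBin 0 θ)
    (X := fun n : ℕ => (n : ℝ)) (by fun_prop) hp (negBin_zero_eq_withDensity_count θ)
    (by fun_prop) (fun x _ => hscore x), variance_cast_negBin]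
  field_simp
  simp

theorem cramerRaoBound_neg_log_geometric (ν : ℕ) (θ : Set.Ioo (0 : ℝ) 1) :
    cramerRaoBound Measure.count (fun (t : ℝ) (x : ℕ) => t * (1 - t) ^ x)
      (fun t => -Real.log t) ν θ = (1 - (θ : ℝ)) / ν := by
  have hθ : (0 : ℝ) < θ := θ.2.1
  have hq : 0 < 1 - (θ : ℝ) := sub_pos.2 θ.2.2
  rw [cramerRaoBound, fisherInformation_geometric, deriv.fun_neg, Real.deriv_log]
  field_simp

end Geometric

end PearsonUMVUE

theorem mainTheorem8 :
    -- the exponential model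
    (∀ (ν : ℕ) (hν : 1 ≤ ν),
      -- `L_ν` is the (almost surely unique) UMVUE of `log l`
      PearsonUMVUE.IsUMVUE (fun l : Set.Ioi (0 : ℝ) => PearsonUMVUE.expSample ν l)
        (fun l => Real.log l) (PearsonUMVUE.L ν) ∧
      (∀ L' : (Fin ν → ℝ) → ℝ,
        PearsonUMVUE.IsUMVUE (fun l : Set.Ioi (0 : ℝ) => PearsonUMVUE.expSample ν l)
          (fun l => Real.log l) L' →
        ∀ l : ℝ, 0 < l → L' =ᵐ[PearsonUMVUE.expSample ν l] PearsonUMVUE.L ν) ∧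
      ∀ l : ℝ, 0 < l →
        -- `E[-γ - log X₁ | X] = L_ν`
        ((PearsonUMVUE.expSample ν l)[fun x : Fin ν → ℝ =>
              -Real.eulerMascheroniConstant - Real.log (x ⟨0, hν⟩) |
            MeasurableSpace.comap (fun x : Fin ν → ℝ => ∑ i, x i) inferInstance]
          =ᵐ[PearsonUMVUE.expSample ν l] PearsonUMVUE.L ν) ∧
        -- the variance series (its `k`-th term here is the term of index `k + 1 ≥ 1`)
        HasSum (fun k : ℕ => 1 / (((k : ℝ) + 1) ^ 2 * ((ν + k).choose (k + 1) : ℝ)))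
          (variance (PearsonUMVUE.L ν) (PearsonUMVUE.expSample ν l)) ∧
        -- `∑_{k ≥ ν} 1 / k²`
        HasSum (fun k : ℕ => 1 / ((ν : ℝ) + k) ^ 2)
          (variance (PearsonUMVUE.L ν) (PearsonUMVUE.expSample ν l)) ∧
        variance (PearsonUMVUE.L ν) (PearsonUMVUE.expSample ν l) =
          Real.pi ^ 2 / 6 - ∑ j ∈ Finset.Ico 1 ν, 1 / (j : ℝ) ^ 2 ∧
        -- the first term of the variance series is the Cramér–Rao bound
        PearsonUMVUE.cramerRaoBound volume exponentialPDFReal Real.log ν l = 1 / ν ∧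
        1 < ν * variance (PearsonUMVUE.L ν) (PearsonUMVUE.expSample ν l) ∧
        ν * variance (PearsonUMVUE.L ν) (PearsonUMVUE.expSample ν l) < 1 + 1 / (ν : ℝ)) ∧
    -- asymptotic efficiency of `L_ν`
    (∀ l : ℝ, 0 < l →
      Filter.Tendsto
        (fun ν : ℕ => variance (PearsonUMVUE.L ν) (PearsonUMVUE.expSample ν l) /
          PearsonUMVUE.cramerRaoBound volume exponentialPDFReal Real.log ν l)
        Filter.atTop (nhds 1)) ∧
    -- the geometric model
    (∀ ν : ℕ, 1 ≤ ν →
      PearsonUMVUE.IsUMVUE (PearsonUMVUE.geomSample ν)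
        (fun θ => -Real.log θ) (PearsonUMVUE.T ν) ∧
      (∀ T' : (Fin ν → ℕ) → ℝ,
        PearsonUMVUE.IsUMVUE (PearsonUMVUE.geomSample ν) (fun θ => -Real.log θ) T' →
        ∀ θ, T' =ᵐ[PearsonUMVUE.geomSample ν θ] PearsonUMVUE.T ν) ∧
      ∀ θ : Set.Ioo (0 : ℝ) 1,
        HasSum (fun k : ℕ => (1 - (θ : ℝ)) ^ (k + 1) /
            (((k : ℝ) + 1) ^ 2 * ((ν + k).choose (k + 1) : ℝ)))
          (variance (PearsonUMVUE.T ν) (PearsonUMVUE.geomSample ν θ)) ∧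
        PearsonUMVUE.cramerRaoBound Measure.count
            (fun (t : ℝ) (x : ℕ) => t * (1 - t) ^ x) (fun t => -Real.log t) ν θ =
          (1 - (θ : ℝ)) / ν) := by
  refine ⟨fun ν hν => ⟨PearsonUMVUE.isUMVUE_L hν,
      fun L' hL' l hl => PearsonUMVUE.ae_eq_L_of_isUMVUE hν hL' hl, fun l hl => ?_⟩,
    fun l hl => PearsonUMVUE.tendsto_variance_L_div_cramerRaoBound hl,
    fun ν hν => ⟨PearsonUMVUE.isUMVUE_T hν,
      fun T' hT' θ => PearsonUMVUE.ae_eq_T_of_isUMVUE hν hT' θ,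
      fun θ => ⟨PearsonUMVUE.hasSum_variance_T hν θ,
        PearsonUMVUE.cramerRaoBound_neg_log_geometric ν θ⟩⟩⟩
  have hν' : (0 : ℝ) < ν := by positivity
  have htrigamma := PearsonUMVUE.hasSum_variance_L hν hl
  have hvar := PearsonUMVUE.variance_L hν hl
  exact ⟨PearsonUMVUE.condExp_sum_ae_eq_L ⟨0, hν⟩ hl,
    hvar ▸ PearsonUMVUE.hasSum_one_div_sq_mul_choose hν, htrigamma, hvar,
    PearsonUMVUE.cramerRaoBound_log_exponentialPDFReal ν hl,
    PearsonUMVUE.one_lt_mul_of_hasSum_one_div_add_sq hν' htrigamma,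
    PearsonUMVUE.mul_lt_of_hasSum_one_div_add_sq hν' htrigamma⟩
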